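/- Let $\Delta_n(x)=\prod_{1\le j<k\le n}(x_k-x_j)$. For (Lebesgue) measurable functions $v_1,\dots,v_n:\mathbb R\to\mathbb R$ and a random $n\times n$ complex Hermitian matrix $M$, write $M\sim PE(v_1,\dots,v_n)$ if the joint distribution of the eigenvalues of $M$, taken in uniformly random order, is absolutely continuous on $\mathbb R^n$ with a probability density of the form $$\frac1{Z}\,\Delta_n(x)\,\det\bigl[v_k(x_j)\bigr]_{j,k=1}^n$$ for some real constant $Z\neq0$ (the density being nonnegative almost everywhere). Write $M\sim DPE(w)$ if $w:\mathbb R\to\mathbb R$ has derivatives up to order $n-1$, in the sense that for $n\ge2$ it is $n-2$ times differentiable with $w^{(n-2)}$ locally absolutely continuous (so that $w^{(n-1)}$ exists almost everywhere; no condition if $n = 1$), and $M\sim PE(w,w',\dots,w^{(n-1)})$. Call $M$ unitarily invariant if $UMU^*$ has the same distribution as $M$ for every unitary matrix $U$. Let $X$ and $Y$ be independent, unitarily invariant random $n\times n$ Hermitian matrices with $X\sim DPE(w)$ and $Y\sim PE(w_1,\dots,w_n)$. Then for every $k$ the convolution $$(w*w_k)(x)=\int_{-\infty}^{\infty}w(x-y)\,w_k(y)\,dy$$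 exists (as an absolutely convergent integral) for almost every $x\in\mathbb R$, and $$X+Y\sim PE(w*w_1,\dots,w*w_n).$$ -/

import Mathlib

open MeasureTheory ProbabilityTheory
open scoped Convolution Nat Matrix

noncomputable section

namespace RandomHermitian

/-- The real vector space of complex Hermitian `n × n` matrices. -/
abbrev Herm (n : ℕ) : Type := selfAdjoint (Matrix (Fin n) (Fin n) ℂ)

/-- The Borel sigma-algebra on the space of Hermitian matrices. -/
instance instMeasurableSpaceHerm (n : ℕ) : MeasurableSpace (Herm n) := borel _

instance instBorelSpaceHerm (n : ℕ) : BorelSpace (Herm n) := ⟨rfl⟩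

/-- The conjugate `U A U*` of a Hermitian matrix `A` by a unitary matrix `U`. -/
def conj {n : ℕ} (U : Matrix.unitaryGroup (Fin n) ℂ) (A : Herm n) : Herm n :=
  ⟨(U : Matrix (Fin n) (Fin n) ℂ) * (A : Matrix (Fin n) (Fin n) ℂ) *
      star (U : Matrix (Fin n) (Fin n) ℂ), A.2.conjugate _⟩

/-- A random Hermitian matrix with law `μ` is unitarily invariant if `U X U*` has the same law
as `X` for every unitary matrix `U`. -/
def UnitarilyInvariant {n : ℕ} (μ : Measure (Herm n)) : Prop :=
  ∀ U : Matrix.unitaryGroup (Fin n) ℂ, μ.map (conj U) = μ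

/-- The eigenvalues of a Hermitian matrix, repeated according to multiplicity. -/
def eigenvalues {n : ℕ} (A : Herm n) : Fin n → ℝ :=
  Matrix.IsHermitian.eigenvalues (A := (A : Matrix (Fin n) (Fin n) ℂ)) A.2

/-- The joint distribution on `ℝⁿ` of the eigenvalues, taken in uniformly random order, of a random
Hermitian matrix with law `μ`. -/
def eigenvalueLaw {n : ℕ} (μ : Measure (Herm n)) : Measure (Fin n → ℝ) :=
  ((n ! : ℕ) : ENNReal)⁻¹ •
    ∑ σ : Equiv.Perm (Fin n), μ.map (fun A => fun i => eigenvalues A (σ i))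

/-- The Vandermonde determinant `∏_{j < k} (x_k - x_j)`. -/
def vandermondeDet {n : ℕ} (x : Fin n → ℝ) : ℝ :=
  (Matrix.vandermonde x).det

/-- `Z⁻¹ * Δ(x) * det [v_k (x_j)]`. -/
def ensembleDensity {n : ℕ} (v : Fin n → ℝ → ℝ) (Z : ℝ) (x : Fin n → ℝ) : ℝ :=
  Z⁻¹ * (vandermondeDet x * (Matrix.of fun j k : Fin n => v k (x j)).det)

/-- `PE(v_1, …, v_n)`: the eigenvalues of a random Hermitian matrix with law `μ` have a probability
density of the form `Z⁻¹ * Δ(x) * det [v_k (x_j)]`. -/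
def IsPE {n : ℕ} (v : Fin n → ℝ → ℝ) (μ : Measure (Herm n)) : Prop :=
  IsProbabilityMeasure μ ∧ (∀ k, AEMeasurable (v k) volume) ∧
    ∃ Z : ℝ, Z ≠ 0 ∧ (∀ᵐ x : Fin n → ℝ, 0 ≤ ensembleDensity v Z x) ∧
      eigenvalueLaw μ = volume.withDensity (fun x => ENNReal.ofReal (ensembleDensity v Z x))

/-- The derivatives `w, w', …, w^(n-1)` exist, the last one almost everywhere: `w` has `n - 2`
derivatives everywhere and `w^(n-2)` is locally absolutely continuous (no condition
if `n ≤ 1`). -/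
def HasDerivatives (n : ℕ) (w : ℝ → ℝ) : Prop :=
  (∀ k : ℕ, k + 2 < n → Differentiable ℝ (iteratedDeriv k w)) ∧
    ∀ k : ℕ, k + 1 < n → ∀ a b : ℝ, AbsolutelyContinuousOnInterval (iteratedDeriv k w) a b

/-- `DPE(w)`: the polynomial ensemble of derivative type `PE(w, w', …, w^(n-1))`. -/
def IsDPE {n : ℕ} (w : ℝ → ℝ) (μ : Measure (Herm n)) : Prop :=
  HasDerivatives n w ∧ IsPE (fun k : Fin n => iteratedDeriv (k : ℕ) w) μ

end RandomHermitian

end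

/-! ### Tuples with the same multiset of entries -/

/-! The proof is harmonic analysis on Hermitian matrices. For a unitarily invariant law, the Fourier
transform at `V diag(s) V*` is the integral of the spherical function `K(s, x) = ∫ exp(i tr(diag(s)
U diag(x) U*)) dU` against the eigenvalue law. The Harish-Chandra–Itzykson–Zuber formula `Δ(s) Δ(x)
K(s, x) = c det[exp(i s_j x_k)]` cancels the Vandermonde factor of a polynomial ensemble, and
Andréief's identity then turns `Δ(s)` times the transform into a constant times `det[v̂_k(s_j)]`.
For derivative type, `v̂_k(s) = (-is)^k ŵ(s)`, so the determinant is `Δ(s) ∏ ŵ(s_j)` up to a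
constant and the transform of `X` is a pure product.

Independence multiplies transforms. The factors `ŵ(s_j)` enter the rows of `det[v̂_k(s_j)]` and
produce the transforms of `w * v_k`. Thus `X + Y` has the spherical transform of the candidate
density, and Fourier uniqueness identifies the eigenvalue law (`eigenvalueLaw_eq_withDensity`);
nonnegativity of the candidate is part of that conclusion.

Two ingredients need real work. First, `integrable_weight` extracts integrability of `(1 +
|y|)^(n-1) v_k` from integrability of the joint density, by Cramer's rule at generic points; all
convolutions, Fourier transforms and integrations by parts rest on it. Second,
`exists_sphericalKernel_eq` proves the HCIZ formula by induction on the size. After a shift making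
`s_0 = 0`, the spherical function averages the smaller one over the eigenvalues `y` of a principal
minor of `U diag(x) U*`. These have density `m! Δ(y)/Δ(x)` on the tuples interlacing `x`, found by
realizing a row of a Haar unitary as a normalized Gaussian vector and changing variables through the
secular equation. -/

theorem exists_perm_of_univ_val_map_eq {n : ℕ} {α : Type*} [LinearOrder α] {f g : Fin n → α}
    (h : Finset.univ.val.map f = Finset.univ.val.map g) :
    ∃ σ : Equiv.Perm (Fin n), f = g ∘ σ := by
  have hperm : List.Perm (List.ofFn f) (List.ofFn g) := by
    simpa [Fin.univ_val_map] using h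
  have hsort : f ∘ Tuple.sort f = g ∘ Tuple.sort g := by
    rw [← List.ofFn_inj]
    refine List.Perm.eq_of_pairwise' (r := (· ≤ ·)) ?_ ?_ ?_
    · exact List.sortedLE_iff_pairwise.1 (Tuple.monotone_sort f).sortedLE_ofFn
    · exact List.sortedLE_iff_pairwise.1 (Tuple.monotone_sort g).sortedLE_ofFn
    · exact ((Equiv.Perm.ofFn_comp_perm _ f).trans hperm).trans
        (Equiv.Perm.ofFn_comp_perm _ g).symm
  refine ⟨(Tuple.sort f)⁻¹.trans (Tuple.sort g), ?_⟩
  ext i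
  have := congrFun hsort ((Tuple.sort f)⁻¹ i)
  simpa using this

theorem exists_perm_of_prod_X_sub_C_eq {n : ℕ} {f g : Fin n → ℝ}
    (h : ∏ i, (Polynomial.X - Polynomial.C (f i : ℂ)) =
      ∏ i, (Polynomial.X - Polynomial.C (g i : ℂ))) :
    ∃ σ : Equiv.Perm (Fin n), f = g ∘ σ := by
  apply exists_perm_of_univ_val_map_eq
  have h' := congrArg (fun p => p.roots.map Complex.re) h
  simpa [Polynomial.roots_prod, Finset.prod_ne_zero_iff, Polynomial.X_sub_C_ne_zero,
    Function.comp_def] using h'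

namespace RandomHermitian

noncomputable section

/-! ### The unitary group and its Haar measure -/

/-- The unitary group of complex `n × n` matrices. -/
abbrev UG (n : ℕ) : Type := Matrix.unitaryGroup (Fin n) ℂ

instance instMeasurableSpaceUG (n : ℕ) : MeasurableSpace (UG n) := borel _

instance instBorelSpaceUG (n : ℕ) : BorelSpace (UG n) := ⟨rfl⟩

instance instSecondCountableTopologyMatrix (n : ℕ) :
    SecondCountableTopology (Matrix (Fin n) (Fin n) ℂ) :=
  inferInstanceAs (SecondCountableTopology (Fin n → Fin n → ℂ))

instance instPolishSpaceMatrix (n : ℕ) : PolishSpace (Matrix (Fin n) (Fin n) ℂ) :=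
  inferInstanceAs (PolishSpace (Fin n → Fin n → ℂ))

instance instLocallyCompactSpaceMatrix (n : ℕ) :
    LocallyCompactSpace (Matrix (Fin n) (Fin n) ℂ) :=
  inferInstanceAs (LocallyCompactSpace (Fin n → Fin n → ℂ))

theorem isClosedEmbedding_coe_herm (n : ℕ) :
    Topology.IsClosedEmbedding ((↑) : Herm n → Matrix (Fin n) (Fin n) ℂ) := by
  refine Topology.IsClosedEmbedding.subtypeVal ?_
  have : {x : Matrix (Fin n) (Fin n) ℂ | x ∈ selfAdjoint (Matrix (Fin n) (Fin n) ℂ)} =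
      {x | star x = x} := by
    ext x; exact selfAdjoint.mem_iff
  rw [this]
  exact isClosed_eq continuous_star continuous_id

instance instPolishSpaceHerm (n : ℕ) : PolishSpace (Herm n) :=
  (isClosedEmbedding_coe_herm n).polishSpace

instance instLocallyCompactSpaceHerm (n : ℕ) : LocallyCompactSpace (Herm n) :=
  (isClosedEmbedding_coe_herm n).locallyCompactSpace

instance instSecondCountableTopologyUG (n : ℕ) : SecondCountableTopology (UG n) :=
  TopologicalSpace.Subtype.secondCountableTopology _

instance instCompactSpaceUG (n : ℕ) : CompactSpace (UG n) := by
  rw [← isCompact_univ_iff]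
  have hcl : Topology.IsClosedEmbedding ((↑) : UG n → Matrix (Fin n) (Fin n) ℂ) :=
    Topology.IsClosedEmbedding.subtypeVal isClosed_unitary
  rw [hcl.isEmbedding.isCompact_iff]
  have hK : IsCompact (Set.univ.pi fun _ : Fin n => Set.univ.pi fun _ : Fin n =>
      Metric.closedBall (0 : ℂ) 1) :=
    isCompact_univ_pi fun _ => isCompact_univ_pi fun _ => isCompact_closedBall _ _
  refine IsCompact.of_isClosed_subset hK (by simpa using hcl.isClosed_range) ?_
  rintro _ ⟨U, -, rfl⟩ i - j -
  simpa using entry_norm_bound_of_unitary U.2 i j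

/-- The Haar probability measure on the unitary group. -/
def haarU (n : ℕ) : Measure (UG n) := Measure.haarMeasure ⊤

instance instIsHaarMeasureHaarU (n : ℕ) : (haarU n).IsHaarMeasure :=
  inferInstanceAs (Measure.haarMeasure _).IsHaarMeasure

instance instIsProbabilityMeasureHaarU (n : ℕ) : IsProbabilityMeasure (haarU n) :=
  ⟨by simpa [haarU] using
    Measure.haarMeasure_self (K₀ := (⊤ : TopologicalSpace.PositiveCompacts (UG n)))⟩

/-- A right translate of Haar measure is still left invariant, hence a multiple of it; comparing
total masses on the compact group forces the factor to be one. -/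
instance instIsMulRightInvariantHaarU (n : ℕ) : (haarU n).IsMulRightInvariant := by
  refine ⟨fun g => ?_⟩
  have h := Measure.isMulInvariant_eq_smul_of_compactSpace ((haarU n).map (· * g)) (haarU n)
  have : IsProbabilityMeasure ((haarU n).map (· * g)) :=
    Measure.isProbabilityMeasure_map (measurable_mul_const g).aemeasurable
  have h1 := congrArg (fun μ : Measure (UG n) => μ Set.univ) h
  simp only [measure_univ, Measure.smul_apply] at h1
  have h2 : ((haarU n).map (· * g)).haarScalarFactor (haarU n) = 1 := by
    rw [ENNReal.smul_def, smul_eq_mul, mul_one] at h1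
    exact_mod_cast h1.symm
  rw [h, h2, one_smul]

/-! ### Conjugation and diagonalization -/

theorem coe_conj {n : ℕ} (U : UG n) (A : Herm n) :
    (conj U A : Matrix (Fin n) (Fin n) ℂ) = U * A * star (U : Matrix (Fin n) (Fin n) ℂ) := rfl

theorem conj_mul {n : ℕ} (U V : UG n) (A : Herm n) : conj (U * V) A = conj U (conj V A) := by
  ext1
  simp [coe_conj, mul_assoc]

theorem conj_one {n : ℕ} (A : Herm n) : conj 1 A = A := by
  ext1
  simp [coe_conj]

@[fun_prop]
theorem continuous_coe_herm {n : ℕ} :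
    Continuous fun A : Herm n => (A : Matrix (Fin n) (Fin n) ℂ) :=
  continuous_subtype_val

@[fun_prop]
theorem continuous_conj {n : ℕ} {T : Type*} [TopologicalSpace T] {f : T → UG n} {g : T → Herm n}
    (hf : Continuous f) (hg : Continuous g) : Continuous fun t => conj (f t) (g t) := by
  refine continuous_induced_rng.2 ?_
  simp only [Function.comp_def, coe_conj]
  have h1 : Continuous fun t => (f t : Matrix (Fin n) (Fin n) ℂ) := continuous_subtype_val.comp hf
  have h2 : Continuous fun t => (g t : Matrix (Fin n) (Fin n) ℂ) := continuous_subtype_val.comp hg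
  fun_prop

/-- The diagonal Hermitian matrix with prescribed real entries. -/
def hdiag {n : ℕ} (x : Fin n → ℝ) : Herm n :=
  ⟨Matrix.diagonal fun i => (x i : ℂ), by
    rw [selfAdjoint.mem_iff, Matrix.star_eq_conjTranspose, Matrix.diagonal_conjTranspose]
    congr 1
    ext i
    simp⟩

theorem coe_hdiag {n : ℕ} (x : Fin n → ℝ) :
    (hdiag x : Matrix (Fin n) (Fin n) ℂ) = Matrix.diagonal fun i => (x i : ℂ) := rfl

@[fun_prop]
theorem continuous_hdiag {n : ℕ} {T : Type*} [TopologicalSpace T] {f : T → Fin n → ℝ}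
    (hf : Continuous f) : Continuous fun t => hdiag (f t) := by
  refine continuous_induced_rng.2 ?_
  simp only [Function.comp_def, coe_hdiag]
  fun_prop

theorem exists_conj_hdiag_eigenvalues {n : ℕ} (A : Herm n) :
    ∃ U : UG n, A = conj U (hdiag (eigenvalues A)) := by
  refine ⟨Matrix.IsHermitian.eigenvectorUnitary (A := (A : Matrix (Fin n) (Fin n) ℂ)) A.2, ?_⟩
  ext1
  have h := Matrix.IsHermitian.spectral_theorem (A := (A : Matrix (Fin n) (Fin n) ℂ)) A.2
  rw [Unitary.conjStarAlgAut_apply] at h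
  exact h

theorem charpoly_conj_hdiag {n : ℕ} (U : UG n) (x : Fin n → ℝ) :
    (conj U (hdiag x) : Matrix (Fin n) (Fin n) ℂ).charpoly =
      ∏ i, (Polynomial.X - Polynomial.C (x i : ℂ)) := by
  rw [coe_conj, Matrix.charpoly_mul_comm, ← mul_assoc]
  simp [coe_hdiag, Matrix.charpoly_diagonal]

theorem charpoly_eq_prod_eigenvalues {n : ℕ} (A : Herm n) :
    (A : Matrix (Fin n) (Fin n) ℂ).charpoly =
      ∏ i, (Polynomial.X - Polynomial.C (eigenvalues A i : ℂ)) := by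
  obtain ⟨U, hU⟩ := exists_conj_hdiag_eigenvalues A
  conv_lhs => rw [hU, charpoly_conj_hdiag]

theorem exists_perm_eigenvalues_eq {n : ℕ} {A : Herm n} {y : Fin n → ℝ}
    (h : (A : Matrix (Fin n) (Fin n) ℂ).charpoly =
      ∏ i, (Polynomial.X - Polynomial.C (y i : ℂ))) :
    ∃ σ : Equiv.Perm (Fin n), eigenvalues A = y ∘ σ :=
  exists_perm_of_prod_X_sub_C_eq ((charpoly_eq_prod_eigenvalues A).symm.trans h)

theorem exists_perm_eigenvalues_conj_hdiag {n : ℕ} (U : UG n) (y : Fin n → ℝ) :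
    ∃ σ : Equiv.Perm (Fin n), eigenvalues (conj U (hdiag y)) = y ∘ σ :=
  exists_perm_eigenvalues_eq (charpoly_conj_hdiag U y)

/-! ### Continuity of the ordered eigenvalues -/

/-- The reordering of indices for which `eigenvalues` is decreasing. -/
def eigenvalueOrder (n : ℕ) : Fin n ≃ Fin n :=
  (finCongr (Fintype.card_fin n)).symm.trans (Fintype.equivOfCardEq (Fintype.card_fin _))

theorem antitone_eigenvalues {n : ℕ} (A : Herm n) :
    Antitone (eigenvalues A ∘ eigenvalueOrder n) := by
  intro i j hij
  have h := Matrix.IsHermitian.eigenvalues₀_antitone (A := (A : Matrix (Fin n) (Fin n) ℂ)) A.2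
  have := h (a := (finCongr (Fintype.card_fin n)).symm i)
    (b := (finCongr (Fintype.card_fin n)).symm j) (by simpa using hij)
  simpa [eigenvalues, Matrix.IsHermitian.eigenvalues, eigenvalueOrder] using this

theorem eigenvalues_conj_hdiag_of_antitone {n : ℕ} (U : UG n) {y : Fin n → ℝ}
    (hy : Antitone (y ∘ eigenvalueOrder n)) : eigenvalues (conj U (hdiag y)) = y := by
  obtain ⟨σ, hσ⟩ := exists_perm_eigenvalues_conj_hdiag U y
  have h1 := antitone_eigenvalues (conj U (hdiag y))
  rw [hσ] at h1 ⊢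
  set e := eigenvalueOrder n
  have h2 : (y ∘ e) ∘ ((e.trans σ).trans e.symm) = y ∘ σ ∘ e := by
    ext i; simp
  -- Both `y` and its rearrangement are decreasing along `e`; the order dual makes uniqueness of the
  -- sorted rearrangement applicable, even with repeated entries.
  have h3 := Tuple.unique_monotone (α := ℝᵒᵈ) (f := OrderDual.toDual ∘ y ∘ e)
    (σ := (e.trans σ).trans e.symm) (τ := 1)
    (by
      rw [Function.comp_assoc, h2]
      exact h1.dual_right)
    (by
      rw [Function.comp_assoc]
      exact hy.dual_right)
  ext i
  have h4 := congrFun h3 (e.symm i)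
  simpa using h4

/-- Serves twice: it bounds eigenvalues on compact sets of matrices, and it makes the trace pairing
definite. -/
theorem trace_sq_conj_hdiag {n : ℕ} (U : UG n) (y : Fin n → ℝ) :
    (((conj U (hdiag y) : Matrix (Fin n) (Fin n) ℂ) *
      (conj U (hdiag y) : Matrix (Fin n) (Fin n) ℂ)).trace).re = ∑ i, y i ^ 2 := by
  have h1 : star (U : Matrix (Fin n) (Fin n) ℂ) * (U : Matrix (Fin n) (Fin n) ℂ) = 1 :=
    Unitary.coe_star_mul_self U
  have h2 : (conj U (hdiag y) : Matrix (Fin n) (Fin n) ℂ) *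
      (conj U (hdiag y) : Matrix (Fin n) (Fin n) ℂ) =
        U * (Matrix.diagonal fun i => (y i : ℂ) * y i) *
          star (U : Matrix (Fin n) (Fin n) ℂ) := by
    rw [coe_conj, ← Matrix.diagonal_mul_diagonal, ← coe_hdiag]
    generalize (hdiag y : Matrix (Fin n) (Fin n) ℂ) = D
    generalize (U : Matrix (Fin n) (Fin n) ℂ) = V at h1 ⊢
    calc V * D * star V * (V * D * star V) = V * D * (star V * V) * D * star V := by
          simp only [mul_assoc]
      _ = V * (D * D) * star V := by rw [h1, mul_one]; simp only [mul_assoc]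
  rw [h2, Matrix.trace_mul_comm, ← mul_assoc, h1, one_mul]
  simp [Matrix.trace, pow_two]

/-- The tuples that are decreasing in the order used by `eigenvalues`. -/
def orderedTuples (n : ℕ) : Set (Fin n → ℝ) := {y | Antitone (y ∘ eigenvalueOrder n)}

theorem isClosed_orderedTuples (n : ℕ) : IsClosed (orderedTuples n) :=
  (isClosed_antitone (α := ℝ) (β := Fin n)).preimage
    (f := fun y : Fin n → ℝ => y ∘ eigenvalueOrder n) (by fun_prop)

/-- The spectral parametrization `(U, y) ↦ U diag(y) U*` by ordered tuples. -/
def spectralMap (n : ℕ) (p : UG n × orderedTuples n) : Herm n := conj p.1 (hdiag p.2.1)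

theorem continuous_spectralMap (n : ℕ) : Continuous (spectralMap n) := by
  unfold spectralMap
  fun_prop

theorem surjective_spectralMap (n : ℕ) : Function.Surjective (spectralMap n) := fun A => by
  obtain ⟨U, hU⟩ := exists_conj_hdiag_eigenvalues A
  exact ⟨(U, ⟨eigenvalues A, antitone_eigenvalues A⟩), hU.symm⟩

theorem continuous_re_trace_sq (n : ℕ) : Continuous fun A : Herm n =>
    (((A : Matrix (Fin n) (Fin n) ℂ) * (A : Matrix (Fin n) (Fin n) ℂ)).trace).re :=
  Complex.continuous_re.comp (Continuous.matrix_trace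
    (continuous_subtype_val.mul continuous_subtype_val))

/-- The unitary group is compact, and `tr A²`, bounded on a compact set, bounds the ordered tuple.
-/
theorem isProperMap_spectralMap (n : ℕ) : IsProperMap (spectralMap n) := by
  rw [isProperMap_iff_isCompact_preimage]
  refine ⟨continuous_spectralMap n, fun K hK => ?_⟩
  obtain ⟨R, hR⟩ := (hK.image (continuous_re_trace_sq n)).bddAbove
  have hcpt : IsCompact ((Set.univ : Set (UG n)) ×ˢ
      ((↑) ⁻¹' (Set.univ.pi fun _ : Fin n => Set.Icc (-(|R| + 1)) (|R| + 1)) :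
        Set (orderedTuples n))) :=
    isCompact_univ.prod ((isClosed_orderedTuples n).isClosedEmbedding_subtypeVal.isCompact_preimage
      (isCompact_univ_pi fun _ => isCompact_Icc))
  refine hcpt.of_isClosed_subset (hK.isClosed.preimage (continuous_spectralMap n)) ?_
  intro p hp
  refine ⟨trivial, fun i _ => ?_⟩
  have h1 : ∑ i, (p.2.1 i) ^ 2 ≤ R := by
    rw [← trace_sq_conj_hdiag p.1]
    exact hR ⟨_, hp, rfl⟩
  have h2 : (p.2.1 i) ^ 2 ≤ ∑ i, (p.2.1 i) ^ 2 :=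
    Finset.single_le_sum (f := fun i => (p.2.1 i) ^ 2) (fun _ _ => sq_nonneg _)
      (Finset.mem_univ i)
  rw [Set.mem_Icc, ← abs_le]
  have h3 := le_abs_self R
  nlinarith [sq_abs (p.2.1 i), abs_nonneg (p.2.1 i), abs_nonneg R]

/-- A proper continuous surjection is a quotient map, and after composition with `spectralMap` the
eigenvalues are just the second projection. No perturbation estimate is needed. -/
theorem continuous_eigenvalues (n : ℕ) : Continuous (eigenvalues : Herm n → Fin n → ℝ) := by
  rw [((isProperMap_spectralMap n).isClosedMap.isQuotientMap (continuous_spectralMap n)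
    (surjective_spectralMap n)).continuous_iff]
  have : eigenvalues ∘ spectralMap n = fun p => p.2.1 := by
    ext1 p
    exact eigenvalues_conj_hdiag_of_antitone p.1 p.2.2
  rw [this]
  exact continuous_subtype_val.comp continuous_snd

theorem measurable_eigenvalues (n : ℕ) : Measurable (eigenvalues : Herm n → Fin n → ℝ) :=
  (continuous_eigenvalues n).measurable

/-! ### The Fourier transform on Hermitian matrices and the spherical kernel -/

/-- The trace pairing of Hermitian matrices. -/
def pairing {n : ℕ} (S A : Herm n) : ℝ :=
  (((S : Matrix (Fin n) (Fin n) ℂ) * (A : Matrix (Fin n) (Fin n) ℂ)).trace).re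

@[fun_prop]
theorem continuous_pairing {n : ℕ} {T : Type*} [TopologicalSpace T] {f g : T → Herm n}
    (hf : Continuous f) (hg : Continuous g) : Continuous fun t => pairing (f t) (g t) := by
  unfold pairing
  have h1 : Continuous fun t => (f t : Matrix (Fin n) (Fin n) ℂ) := continuous_subtype_val.comp hf
  have h2 : Continuous fun t => (g t : Matrix (Fin n) (Fin n) ℂ) := continuous_subtype_val.comp hg
  exact Complex.continuous_re.comp (h1.mul h2).matrix_trace

theorem pairing_add_right {n : ℕ} (S A B : Herm n) :
    pairing S (A + B) = pairing S A + pairing S B := by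
  simp [pairing, mul_add]

theorem pairing_conj_left {n : ℕ} (V : UG n) (S A : Herm n) :
    pairing (conj V S) A = pairing S (conj V⁻¹ A) := by
  have h : ((V⁻¹ : UG n) : Matrix (Fin n) (Fin n) ℂ) = star (V : Matrix (Fin n) (Fin n) ℂ) := rfl
  simp only [pairing, coe_conj, h, star_star]
  rw [mul_assoc, mul_assoc, Matrix.trace_mul_comm]
  simp only [mul_assoc]

theorem pairing_hdiag_left {n : ℕ} (s : Fin n → ℝ) (A : Herm n) :
    pairing (hdiag s) A = ∑ j, s j * ((A : Matrix (Fin n) (Fin n) ℂ) j j).re := by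
  simp [pairing, coe_hdiag, Matrix.trace]

theorem conj_hdiag_apply {n : ℕ} (U : UG n) (x : Fin n → ℝ) (i j : Fin n) :
    (conj U (hdiag x) : Matrix (Fin n) (Fin n) ℂ) i j =
      ∑ k, (x k : ℂ) * (U.1 i k * star (U.1 j k)) := by
  rw [coe_conj, coe_hdiag, Matrix.mul_apply]
  refine Finset.sum_congr rfl fun k _ => ?_
  rw [Matrix.mul_diagonal, Matrix.star_apply]
  ring

theorem conj_hdiag_apply_self {n : ℕ} (U : UG n) (x : Fin n → ℝ) (j : Fin n) :
    (conj U (hdiag x) : Matrix (Fin n) (Fin n) ℂ) j j =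
      ((∑ k, x k * Complex.normSq (U.1 j k) : ℝ) : ℂ) := by
  rw [conj_hdiag_apply]
  push_cast
  refine Finset.sum_congr rfl fun k _ => ?_
  rw [← Complex.mul_conj]
  rfl

theorem pairing_hdiag_conj_hdiag {n : ℕ} (U : UG n) (s x : Fin n → ℝ) :
    pairing (hdiag s) (conj U (hdiag x)) =
      ∑ j, s j * ∑ k, x k * Complex.normSq (U.1 j k) := by
  rw [pairing_hdiag_left]
  refine Finset.sum_congr rfl fun j _ => ?_
  rw [conj_hdiag_apply_self, Complex.ofReal_re]

/-- The function `exp (i t)`. -/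
def expI (t : ℝ) : ℂ := Complex.exp (t * Complex.I)

theorem norm_expI (t : ℝ) : ‖expI t‖ = 1 := Complex.norm_exp_ofReal_mul_I t

theorem expI_add (a b : ℝ) : expI (a + b) = expI a * expI b := by
  simp [expI, add_mul, Complex.exp_add]

theorem expI_zero : expI 0 = 1 := by simp [expI]

@[fun_prop]
theorem continuous_expI : Continuous expI := by unfold expI; fun_prop

theorem expI_sum {ι : Type*} (t : Finset ι) (f : ι → ℝ) :
    expI (∑ i ∈ t, f i) = ∏ i ∈ t, expI (f i) := by
  simp [expI, Finset.sum_mul, Complex.exp_sum]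

/-- The spherical function `∫ exp (i tr (diag(s) U diag(x) U*)) dU`. -/
def sphericalKernel {n : ℕ} (s x : Fin n → ℝ) : ℂ :=
  ∫ U, expI (pairing (hdiag s) (conj U (hdiag x))) ∂haarU n

@[fun_prop]
theorem continuous_sphericalKernel {n : ℕ} {T : Type*} [TopologicalSpace T]
    [FirstCountableTopology T] {f g : T → Fin n → ℝ}
    (hf : Continuous f) (hg : Continuous g) : Continuous fun t => sphericalKernel (f t) (g t) := by
  unfold sphericalKernel
  refine continuous_of_dominated (bound := fun _ => 1) (fun t => ?_) (fun t => ?_)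
    (integrable_const _) (.of_forall fun U => ?_)
  · exact Continuous.aestronglyMeasurable (by fun_prop)
  · exact .of_forall fun U => (norm_expI _).le
  · fun_prop

theorem norm_sphericalKernel_le {n : ℕ} (s x : Fin n → ℝ) : ‖sphericalKernel s x‖ ≤ 1 := by
  refine (norm_integral_le_integral_norm _).trans ?_
  simp [norm_expI]

/-- Left invariance of Haar measure absorbs `V` and right invariance absorbs `W`, so the average
depends on both matrices only through their spectra. -/
theorem integral_expI_pairing_conj {n : ℕ} (V W : UG n) (s x : Fin n → ℝ) :
    ∫ U, expI (pairing (conj V (hdiag s)) (conj U (conj W (hdiag x)))) ∂haarU n =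
      sphericalKernel s x := by
  simp_rw [pairing_conj_left, ← conj_mul, ← mul_assoc]
  rw [integral_mul_left_eq_self (μ := haarU n)
      (fun U => expI (pairing (hdiag s) (conj (U * W) (hdiag x)))) V⁻¹,
    integral_mul_right_eq_self (μ := haarU n)
      (fun U => expI (pairing (hdiag s) (conj U (hdiag x)))) W]
  rfl

theorem integral_expI_pairing_conj_eq {n : ℕ} (V : UG n) (s : Fin n → ℝ) (A : Herm n) :
    ∫ U, expI (pairing (conj V (hdiag s)) (conj U A)) ∂haarU n =
      sphericalKernel s (eigenvalues A) := by
  obtain ⟨W, hW⟩ := exists_conj_hdiag_eigenvalues A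
  conv_lhs => rw [hW]
  exact integral_expI_pairing_conj V W s _

theorem eigenvalues_eq_of_charpoly_eq {n : ℕ} {A B : Herm n}
    (h : (A : Matrix (Fin n) (Fin n) ℂ).charpoly = (B : Matrix (Fin n) (Fin n) ℂ).charpoly) :
    eigenvalues A = eigenvalues B :=
  (Matrix.IsHermitian.eigenvalues_eq_eigenvalues_iff A.2 B.2).2 h

theorem sphericalKernel_eigenvalues_of_charpoly {n : ℕ} (s : Fin n → ℝ) {A : Herm n}
    {y : Fin n → ℝ} (h : (A : Matrix (Fin n) (Fin n) ℂ).charpoly =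
      ∏ i, (Polynomial.X - Polynomial.C (y i : ℂ))) :
    sphericalKernel s (eigenvalues A) = sphericalKernel s y := by
  have h1 : eigenvalues A = eigenvalues (hdiag y) := by
    apply eigenvalues_eq_of_charpoly_eq
    rw [h, coe_hdiag, Matrix.charpoly_diagonal]
  have h2 := integral_expI_pairing_conj_eq 1 s (hdiag y)
  rw [h1, ← h2, conj_one]
  rfl

theorem sphericalKernel_comp_perm {n : ℕ} (s x : Fin n → ℝ) (σ : Equiv.Perm (Fin n)) :
    sphericalKernel s (x ∘ σ) = sphericalKernel s x := by
  rw [← sphericalKernel_eigenvalues_of_charpoly (A := hdiag x) s (y := x),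
    ← sphericalKernel_eigenvalues_of_charpoly (A := hdiag x) s (y := x ∘ σ)]
  · rw [coe_hdiag, Matrix.charpoly_diagonal]
    exact (Equiv.prod_comp σ fun i => (Polynomial.X - Polynomial.C (x i : ℂ))).symm
  · rw [coe_hdiag, Matrix.charpoly_diagonal]

theorem sum_normSq_col {n : ℕ} (U : UG n) (k : Fin n) : ∑ j, Complex.normSq (U.1 j k) = 1 := by
  have h := congrFun (congrFun (Unitary.coe_star_mul_self U) k) k
  rw [Matrix.mul_apply, Matrix.one_apply_eq] at h
  have h' : ∑ j, ((Complex.normSq (U.1 j k) : ℝ) : ℂ) = 1 := by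
    rw [← h]
    refine Finset.sum_congr rfl fun j _ => ?_
    rw [Complex.normSq_eq_conj_mul_self]
    rfl
  exact_mod_cast h'

/-- A scalar matrix `a • 1` pairs with `U diag(x) U*` to `a tr diag(x)`, whatever `U` is. This
allows the normalization `s 0 = 0` in the HCIZ induction. -/
theorem sphericalKernel_shift {n : ℕ} (a : ℝ) (s x : Fin n → ℝ) :
    sphericalKernel s x = expI (a * ∑ k, x k) * sphericalKernel (fun j => s j - a) x := by
  rw [sphericalKernel, sphericalKernel, ← integral_const_mul]
  congr 1
  ext U
  rw [← expI_add, pairing_hdiag_conj_hdiag, pairing_hdiag_conj_hdiag]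
  congr 1
  have h : ∑ j, ∑ k, x k * Complex.normSq (U.1 j k) = ∑ k, x k := by
    rw [Finset.sum_comm]
    simp_rw [← Finset.mul_sum, sum_normSq_col, mul_one]
  rw [← h, Finset.mul_sum, ← Finset.sum_add_distrib]
  exact Finset.sum_congr rfl fun j _ => by ring

/-- The Fourier transform of a measure on Hermitian matrices. -/
def charTransform {n : ℕ} (μ : Measure (Herm n)) (S : Herm n) : ℂ :=
  ∫ A, expI (pairing S A) ∂μ

theorem integrable_expI_pairing {n : ℕ} (μ : Measure (Herm n)) [IsFiniteMeasure μ] (S : Herm n) :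
    Integrable (fun A => expI (pairing S A)) μ :=
  (integrable_const (1 : ℝ)).mono' (Continuous.aestronglyMeasurable (by fun_prop))
    (.of_forall fun A => (norm_expI _).le)

theorem continuous_charTransform {n : ℕ} (μ : Measure (Herm n)) [IsFiniteMeasure μ] :
    Continuous (charTransform μ) := by
  refine continuous_of_dominated (bound := fun _ => 1) (fun S => ?_) (fun S => ?_)
    (integrable_const _) (.of_forall fun A => ?_)
  · exact (integrable_expI_pairing μ S).aestronglyMeasurable
  · exact .of_forall fun A => (norm_expI _).le
  · fun_prop

theorem measurable_conj {n : ℕ} (U : UG n) : Measurable (conj U) := by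
  have h : Continuous fun A : Herm n => conj U A := by fun_prop
  exact h.measurable

theorem charTransform_eq_integral_sphericalKernel {n : ℕ} {μ : Measure (Herm n)}
    [IsFiniteMeasure μ] (hμ : UnitarilyInvariant μ) (V : UG n) (s : Fin n → ℝ) :
    charTransform μ (conj V (hdiag s)) = ∫ A, sphericalKernel s (eigenvalues A) ∂μ := by
  have h1 (U : UG n) : charTransform μ (conj V (hdiag s)) =
      ∫ A, expI (pairing (conj V (hdiag s)) (conj U A)) ∂μ := by
    conv_lhs => rw [← hμ U]
    rw [charTransform, integral_map (measurable_conj U).aemeasurable]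
    exact Continuous.aestronglyMeasurable (by fun_prop)
  have h2 : charTransform μ (conj V (hdiag s)) =
      ∫ U, ∫ A, expI (pairing (conj V (hdiag s)) (conj U A)) ∂μ ∂haarU n := by
    simp_rw [← h1]
    simp
  rw [h2, integral_integral_swap]
  · simp_rw [integral_expI_pairing_conj_eq]
  · refine (integrable_const (1 : ℝ)).mono' (Continuous.aestronglyMeasurable ?_)
      (.of_forall fun A => (norm_expI _).le)
    unfold Function.uncurry
    fun_prop

/-- Finite measures on Hermitian matrices are determined by their Fourier transforms. -/
theorem ext_of_charTransform {n : ℕ} {μ ν : Measure (Herm n)} [IsFiniteMeasure μ]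
    [IsFiniteMeasure ν] (h : ∀ S, charTransform μ S = charTransform ν S) : μ = ν := by
  let _ := TopologicalSpace.upgradeIsCompletelyMetrizable (Herm n)
  let L : Herm n →ₗ[ℝ] Herm n →ₗ[ℝ] ℝ := LinearMap.mk₂ ℝ (fun A S => pairing S A)
    (fun A B S => pairing_add_right S A B) (fun c A S => by simp [pairing])
    (fun A S T => by simp [pairing, add_mul]) (fun c A S => by simp [pairing])
  have hL : Continuous fun p : Herm n × Herm n => L p.1 p.2 := by
    change Continuous fun p : Herm n × Herm n => pairing p.2 p.1
    fun_prop
  refine ext_of_integral_char_eq (L := L) Real.continuous_probChar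
    Real.probChar_ne_one (fun A hA hLA => hA ?_) hL fun S => ?_
  -- Nondegeneracy: `pairing A A` is the sum of the squared eigenvalues.
  · have h1 : pairing A A = 0 := LinearMap.congr_fun hLA A
    have h2 : pairing A A = ∑ i, eigenvalues A i ^ 2 := by
      obtain ⟨U, hU⟩ := exists_conj_hdiag_eigenvalues A
      conv_lhs => rw [hU]
      exact trace_sq_conj_hdiag U _
    have h3 : eigenvalues A = 0 := by
      ext i
      have := (Finset.sum_eq_zero_iff_of_nonneg (fun i _ => sq_nonneg (eigenvalues A i))).1
        (h2.symm.trans h1) i (Finset.mem_univ i)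
      simpa using this
    ext1
    exact (Matrix.IsHermitian.eigenvalues_eq_zero_iff A.2).1 h3
  · exact h S

/-! ### The law of the eigenvalues -/

theorem integral_eigenvalueLaw {n : ℕ} {μ : Measure (Herm n)} [IsFiniteMeasure μ]
    {f : (Fin n → ℝ) → ℂ} (hf : Continuous f) {C : ℝ} (hC : ∀ x, ‖f x‖ ≤ C)
    (hsymm : ∀ (σ : Equiv.Perm (Fin n)) x, f (x ∘ σ) = f x) :
    ∫ x, f x ∂eigenvalueLaw μ = ∫ A, f (eigenvalues A) ∂μ := by
  have hm (σ : Equiv.Perm (Fin n)) :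
      Measurable fun A : Herm n => fun i => eigenvalues A (σ i) := by
    have := measurable_eigenvalues n
    fun_prop
  have h1 (σ : Equiv.Perm (Fin n)) :
      ∫ x, f x ∂(μ.map fun A => fun i => eigenvalues A (σ i)) = ∫ A, f (eigenvalues A) ∂μ := by
    rw [integral_map (hm σ).aemeasurable hf.aestronglyMeasurable]
    exact integral_congr_ae (.of_forall fun A => hsymm σ (eigenvalues A))
  rw [eigenvalueLaw, integral_smul_measure, integral_finsetSum_measure]
  · simp_rw [h1]
    simp only [Finset.sum_const, Finset.card_univ, Fintype.card_perm, Fintype.card_fin]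
    rw [ENNReal.toReal_inv, ENNReal.toReal_natCast, ← Nat.cast_smul_eq_nsmul ℝ, smul_smul,
      inv_mul_cancel₀ (by positivity), one_smul]
  · intro σ _
    have := Measure.isFiniteMeasure_map μ fun A => fun i => eigenvalues A (σ i)
    exact (integrable_const C).mono' hf.aestronglyMeasurable (.of_forall hC)

/-! ### The Andréief identity -/

theorem det_mul_det_eq_sum {n : ℕ} {R : Type*} [CommRing R] (f g : Fin n → Fin n → R) :
    (Matrix.of fun j k => f j k).det * (Matrix.of fun j k => g k j).det =
      ∑ σ : Equiv.Perm (Fin n), ∑ τ : Equiv.Perm (Fin n),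
        ((Equiv.Perm.sign σ : ℤ) : R) * ((Equiv.Perm.sign τ : ℤ) : R) *
          ∏ i, (f (σ i) i * g (τ i) i) := by
  rw [Matrix.det_apply', ← Matrix.det_transpose, Matrix.det_apply', Finset.sum_mul_sum]
  refine Finset.sum_congr rfl fun σ _ => Finset.sum_congr rfl fun τ _ => ?_
  simp only [Matrix.of_apply, Matrix.transpose_apply, Finset.prod_mul_distrib]
  ring

theorem integrable_det_mul_det {n : ℕ} {f g : Fin n → ℝ → ℂ}
    (h : ∀ j k, Integrable fun y => f j y * g k y) :
    Integrable fun x : Fin n → ℝ =>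
      (Matrix.of fun j k => f j (x k)).det * (Matrix.of fun j k => g k (x j)).det := by
  simp_rw [fun x : Fin n → ℝ => det_mul_det_eq_sum (fun j k => f j (x k)) (fun j k => g j (x k))]
  refine integrable_finsetSum _ fun σ _ => integrable_finsetSum _ fun τ _ => ?_
  refine Integrable.const_mul ?_ _
  exact Integrable.fintype_prod (f := fun i y => f (σ i) y * g (τ i) y) fun i => h _ _

/-- Expanding both determinants, each term factors over the coordinates. For fixed `σ` the sum over
`τ` is the moment determinant with rows permuted by `σ`, whose sign cancels `sign σ`; hence `n!`
equal contributions. -/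
theorem integral_det_mul_det {n : ℕ} {f g : Fin n → ℝ → ℂ}
    (h : ∀ j k, Integrable fun y => f j y * g k y) :
    ∫ x : Fin n → ℝ,
      (Matrix.of fun j k => f j (x k)).det * (Matrix.of fun j k => g k (x j)).det =
        (n ! : ℕ) * (Matrix.of fun j k => ∫ y, f j y * g k y).det := by
  have hint (σ τ : Equiv.Perm (Fin n)) : Integrable fun x : Fin n → ℝ =>
      ∏ i, (f (σ i) (x i) * g (τ i) (x i)) :=
    Integrable.fintype_prod (f := fun i y => f (σ i) y * g (τ i) y) fun i => h _ _
  simp_rw [fun x : Fin n → ℝ => det_mul_det_eq_sum (fun j k => f j (x k)) (fun j k => g j (x k))]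
  rw [integral_finsetSum _ fun σ _ => integrable_finsetSum _ fun τ _ => (hint σ τ).const_mul _]
  have h1 (σ : Equiv.Perm (Fin n)) : ∫ x : Fin n → ℝ, ∑ τ : Equiv.Perm (Fin n),
      (((Equiv.Perm.sign σ : ℤ) : ℂ) * ((Equiv.Perm.sign τ : ℤ) : ℂ) *
          ∏ i, (f (σ i) (x i) * g (τ i) (x i))) =
      (Matrix.of fun j k => ∫ y, f j y * g k y).det := by
    rw [integral_finsetSum _ fun τ _ => (hint σ τ).const_mul _]
    have h2 := Matrix.det_permute σ (Matrix.of fun j k => ∫ y, f j y * g k y)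
    have h3 : ((Equiv.Perm.sign σ : ℤ) : ℂ) * ((Equiv.Perm.sign σ : ℤ) : ℂ) = 1 := by
      rw [← Int.cast_mul, Int.units_coe_mul_self, Int.cast_one]
    rw [← one_mul (Matrix.det _), ← h3, mul_assoc, ← h2, ← Matrix.det_transpose,
      Matrix.det_apply', Finset.mul_sum]
    refine Finset.sum_congr rfl fun τ _ => ?_
    rw [integral_const_mul, mul_assoc]
    congr 2
    exact integral_fintype_prod_volume_eq_prod (fun i y => f (σ i) y * g (τ i) y)
  simp_rw [h1]
  simp [Fintype.card_perm]

/-! ### Integrability of the functions defining a polynomial ensemble -/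

theorem vandermondeDet_cons {m : ℕ} (y : ℝ) (z : Fin m → ℝ) :
    vandermondeDet (Fin.cons y z : Fin (m + 1) → ℝ) = (∏ l, (z l - y)) * vandermondeDet z := by
  rw [vandermondeDet, vandermondeDet, Matrix.det_vandermonde, Matrix.det_vandermonde,
    Fin.prod_univ_succ, Fin.prod_Ioi_zero]
  simp [Fin.prod_Ioi_succ]

/-- Cramer's rule read backwards: the signed determinants with row `i` removed and `u` put on top
are the entries of `u * adj M`, and multiplying by `M` returns `det M • u`. A single entry of `u` is
thus recovered from determinants containing `u` as a row. -/
theorem det_mul_eq_sum_cons_succAbove {m : ℕ} {R : Type*} [CommRing R]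
    (M : Matrix (Fin (m + 1)) (Fin (m + 1)) R) (u : Fin (m + 1) → R) (k : Fin (m + 1)) :
    M.det * u k = ∑ i : Fin (m + 1), (-1) ^ (i : ℕ) *
      (Matrix.of (Fin.cons u fun j => M (i.succAbove j))).det * M i k := by
  have h1 (i : Fin (m + 1)) :
      (-1) ^ (i : ℕ) * (Matrix.of (Fin.cons u fun j => M (i.succAbove j))).det =
        ∑ k', u k' * M.adjugate k' i := by
    rw [Matrix.det_succ_row_zero, Finset.mul_sum]
    refine Finset.sum_congr rfl fun k' _ => ?_
    rw [Matrix.adjugate_fin_succ_eq_det_submatrix]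
    have : (Matrix.of (Fin.cons u fun j => M (i.succAbove j))).submatrix Fin.succ k'.succAbove =
        M.submatrix i.succAbove k'.succAbove := by
      ext a b
      simp
    rw [this]
    simp only [Matrix.of_apply, Fin.cons_zero]
    ring
  simp_rw [h1, Finset.sum_mul]
  rw [Finset.sum_comm]
  have h2 (k' : Fin (m + 1)) : ∑ i, u k' * M.adjugate k' i * M i k =
      u k' * (M.det * (1 : Matrix (Fin (m + 1)) (Fin (m + 1)) R) k' k) := by
    have := congrFun (congrFun (Matrix.adjugate_mul M) k') k
    rw [Matrix.mul_apply, Matrix.smul_apply, smul_eq_mul] at this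
    rw [← this, Finset.mul_sum]
    exact Finset.sum_congr rfl fun i _ => by ring
  simp_rw [h2]
  simp [Matrix.one_apply, mul_comm]

/-- Fubini in the first variable, pulled back along the `m + 1` coordinate deletions, so that one
generic point serves all of them. -/
theorem ae_integrable_cons_succAbove {m : ℕ} {F : (Fin (m + 1) → ℝ) → ℝ} (hF : Integrable F) :
    ∀ᵐ x : Fin (m + 1) → ℝ, ∀ i : Fin (m + 1),
      Integrable fun y => F (Fin.cons y fun j => x (i.succAbove j)) := by
  have h1 : ∀ᵐ z : Fin m → ℝ, Integrable fun y => F (Fin.cons y z) := by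
    have h2 : Integrable (fun p : ℝ × (Fin m → ℝ) =>
        F ((MeasurableEquiv.piFinSuccAbove (fun _ => ℝ) 0).symm p)) :=
      ((volume_preserving_piFinSuccAbove (fun _ : Fin (m + 1) => ℝ) 0).symm.integrable_comp_emb
        (MeasurableEquiv.measurableEmbedding _)).2 hF
    filter_upwards [h2.prod_left_ae] with z hz
    refine hz.congr (.of_forall fun y => ?_)
    simp [MeasurableEquiv.piFinSuccAbove, Fin.insertNthEquiv]
  refine ae_all_iff.2 fun i => ?_
  have h3 : Measure.QuasiMeasurePreserving
      (fun x : Fin (m + 1) → ℝ => fun j => x (i.succAbove j)) :=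
    Measure.quasiMeasurePreserving_snd.comp
      (volume_preserving_piFinSuccAbove (fun _ : Fin (m + 1) => ℝ) i).quasiMeasurePreserving
  exact h3.ae h1

/-- The slices through `x` make each determinant with a free row at `y` integrable against `∏ |x_l -
y|`. Away from the points `x_l` this product dominates `(1 + |y|)^m`, and
`det_mul_eq_sum_cons_succAbove` recovers `v k` from the determinants. Near some `x_l` the
Vandermonde factor vanishes and gives no control. -/
theorem integrableOn_weight_of_generic {m : ℕ} {v : Fin (m + 1) → ℝ → ℝ}
    (hv : ∀ k, AEMeasurable (v k)) {x : Fin (m + 1) → ℝ}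
    (hx0 : vandermondeDet x * (Matrix.of fun j k => v k (x j)).det ≠ 0)
    (hx : ∀ i : Fin (m + 1), Integrable fun y =>
      vandermondeDet (Fin.cons y fun j => x (i.succAbove j) : Fin (m + 1) → ℝ) *
        (Matrix.of fun j k => v k ((Fin.cons y fun j => x (i.succAbove j) : Fin (m + 1) → ℝ) j)).det)
    {δ : ℝ} (hδ : 0 < δ) (k : Fin (m + 1)) :
    IntegrableOn (fun y => (1 + |y|) ^ m * v k y) {y | ∀ l, δ ≤ |y - x l|} := by
  have hinj : Function.Injective x := Matrix.det_vandermonde_ne_zero_iff.1 (left_ne_zero_of_mul hx0)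
  have hM := right_ne_zero_of_mul hx0
  set M : Matrix (Fin (m + 1)) (Fin (m + 1)) ℝ := Matrix.of fun j k => v k (x j) with hMdef
  set A : Set ℝ := {y | ∀ l, δ ≤ |y - x l|} with hA
  have hAm : MeasurableSet A := by
    have : IsClosed A := by
      rw [hA, Set.ofPred_forall]
      exact isClosed_iInter fun l => isClosed_le continuous_const (by fun_prop)
    exact this.measurableSet
  let f : Fin (m + 1) → ℝ → ℝ := fun i y =>
    (Matrix.of (Fin.cons (fun k => v k y) fun j => M (i.succAbove j))).det
  have hf (i : Fin (m + 1)) (y : ℝ) : (Matrix.of fun j k =>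
      v k ((Fin.cons y fun j => x (i.succAbove j) : Fin (m + 1) → ℝ) j)).det = f i y := by
    congr 1
    ext a b
    refine Fin.cases ?_ (fun a => ?_) a <;> simp [M]
  have hfm (i : Fin (m + 1)) : AEStronglyMeasurable (f i) := by
    have : f i = fun y => ∑ k' : Fin (m + 1), (-1) ^ (k' : ℕ) * v k' y *
        (M.submatrix i.succAbove k'.succAbove).det := by
      ext y
      simp only [f]
      rw [Matrix.det_succ_row_zero]
      refine Finset.sum_congr rfl fun k' _ => ?_
      congr 1
    rw [this]
    exact Finset.aestronglyMeasurable_fun_sum _ fun k' _ =>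
      ((hv k').aestronglyMeasurable.const_mul _).mul_const _
  obtain ⟨C, hC0, hC⟩ : ∃ C : ℝ, 0 ≤ C ∧ ∀ y ∈ A, ∀ l, 1 + |y| ≤ C * |y - x l| := by
    -- From `|y| ≤ |y - x l| + |x l|`: the summand `1` pays for `|y - x l|`, and the quotient by `δ`
    -- turns the constant `1 + ∑ |x l|` into a multiple of `|y - x l| ≥ δ`.
    refine ⟨(1 + ∑ l, |x l|) / δ + 1, by positivity, fun y hy l => ?_⟩
    have h1 : |x l| ≤ ∑ l, |x l| :=
      Finset.single_le_sum (f := fun l => |x l|) (fun _ _ => abs_nonneg _) (Finset.mem_univ l)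
    have h2 : |y| ≤ |y - x l| + |x l| := by
      simpa using abs_add_le (y - x l) (x l)
    have h3 : 1 + ∑ l, |x l| ≤ (1 + ∑ l, |x l|) / δ * |y - x l| := by
      rw [div_mul_eq_mul_div, le_div_iff₀ hδ]
      exact mul_le_mul_of_nonneg_left (hy l) (by positivity)
    linarith
  have hint (i : Fin (m + 1)) : IntegrableOn (fun y => (1 + |y|) ^ m * f i y) A := by
    have hz : vandermondeDet (fun j => x (i.succAbove j)) ≠ 0 :=
      Matrix.det_vandermonde_ne_zero_iff.2 (hinj.comp (Fin.succAbove_right_injective))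
    set D := vandermondeDet (fun j => x (i.succAbove j))
    have h1 := ((hx i).norm.const_mul (C ^ m / |D|)).integrableOn (s := A)
    refine Integrable.mono h1 ?_ ?_
    · have : Continuous fun y : ℝ => (1 + |y|) ^ m := by fun_prop
      exact (this.aestronglyMeasurable.mul (hfm i)).restrict
    · filter_upwards [ae_restrict_mem hAm] with y hy
      rw [hf, vandermondeDet_cons]
      simp only [norm_mul, Real.norm_eq_abs, Finset.abs_prod, abs_div, abs_pow, abs_abs]
      have h2 : (1 + |y|) ^ m ≤ C ^ m * ∏ j, |x (i.succAbove j) - y| := by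
        calc (1 + |y|) ^ m = ∏ _j : Fin m, (1 + |y|) := by simp
          _ ≤ ∏ j : Fin m, (C * |x (i.succAbove j) - y|) :=
              Finset.prod_le_prod (fun _ _ => by positivity) fun j _ =>
                (abs_sub_comm y (x (i.succAbove j))) ▸ hC y hy (i.succAbove j)
          _ = _ := by simp [Finset.prod_mul_distrib]
      have h3 : abs (1 + |y|) = 1 + |y| := abs_of_nonneg (by positivity)
      have h4 : 0 < |D| := abs_pos.2 hz
      rw [h3, abs_of_nonneg hC0]
      calc (1 + |y|) ^ m * |f i y| ≤ (C ^ m * ∏ j, |x (i.succAbove j) - y|) * |f i y| :=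
            mul_le_mul_of_nonneg_right h2 (abs_nonneg _)
        _ = _ := by
            change _ = C ^ m / |D| * ((∏ j, |x (i.succAbove j) - y|) * |D| * |f i y|)
            field_simp
  have hfin : IntegrableOn (fun y => (M.det)⁻¹ * ∑ i : Fin (m + 1),
      (-1) ^ (i : ℕ) * M i k * ((1 + |y|) ^ m * f i y)) A :=
    (integrable_finsetSum _ fun i _ => (hint i).const_mul _).const_mul _
  refine hfin.congr_fun (fun y _ => ?_) hAm
  have h5 := det_mul_eq_sum_cons_succAbove M (fun k => v k y) k
  have h6 : v k y = (M.det)⁻¹ * ∑ i : Fin (m + 1), (-1) ^ (i : ℕ) * f i y * M i k := by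
    rw [← h5, inv_mul_cancel_left₀ hM]
  simp only [h6, Finset.mul_sum]
  exact Finset.sum_congr rfl fun i _ => by ring

/-- Two generic points with no common coordinate value suffice. With `δ` half the smallest distance
between their coordinates, any `y` within `δ` of a coordinate of one is at least `δ` away from all
coordinates of the other, so the two good regions cover the line. -/
theorem integrable_weight {n : ℕ} {v : Fin n → ℝ → ℝ}
    (hv : ∀ k, AEMeasurable (v k))
    (hF : Integrable fun x : Fin n → ℝ =>
      vandermondeDet x * (Matrix.of fun j k => v k (x j)).det)
    (hne : ∃ᵐ x : Fin n → ℝ, vandermondeDet x * (Matrix.of fun j k => v k (x j)).det ≠ 0)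
    (k : Fin n) : Integrable fun y => (1 + |y|) ^ (n - 1) * v k y := by
  obtain _ | m := n
  · exact k.elim0
  simp only [Nat.add_sub_cancel]
  have hae := ae_integrable_cons_succAbove hF
  obtain ⟨x, hx0, hx⟩ := (hne.and_eventually hae).exists
  have hdisj : ∀ᵐ x' : Fin (m + 1) → ℝ, ∀ j l, x' j ≠ x l :=
    ae_all_iff.2 fun j => ae_all_iff.2 fun l => 
      Measure.ae_eval_ne (fun _ : Fin (m + 1) => (volume : Measure ℝ)) j (x l)
  obtain ⟨x', hx0', hx', hd⟩ := (hne.and_eventually (hae.and hdisj)).exists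
  obtain ⟨p, -, hp⟩ := Finset.exists_min_image (Finset.univ : Finset (Fin (m + 1) × Fin (m + 1)))
    (fun p => |x' p.1 - x p.2|) ⟨(0, 0), Finset.mem_univ _⟩
  have hδ : 0 < |x' p.1 - x p.2| / 2 := half_pos (abs_pos.2 (sub_ne_zero.2 (hd _ _)))
  have hU := (integrableOn_weight_of_generic hv hx0 hx hδ k).union
    (integrableOn_weight_of_generic hv hx0' hx' hδ k)
  rw [← integrableOn_univ]
  refine hU.mono_set fun y _ => ?_
  rw [Set.mem_union, or_iff_not_imp_left]
  intro hy l
  simp only [Set.mem_ofPred_eq, not_forall, not_le] at hy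
  obtain ⟨l', hl'⟩ := hy
  have h1 := hp (l, l') (Finset.mem_univ _)
  have h2 : |x' l - x l'| ≤ |y - x l'| + |y - x' l| := by
    rw [abs_sub_comm y (x' l), add_comm]
    exact abs_sub_le _ _ _
  dsimp only at h1
  linarith

/-! ### Integration by parts on the line -/

/-- No decay of `f` is assumed. The boundary term at `±T` converges because the integral does, and
it is integrable in `T`, so its limit must be zero. -/
theorem integral_deriv_mul_add_mul_deriv_eq_zero {f g : ℝ → ℝ}
    (hf : ∀ a b, AbsolutelyContinuousOnInterval f a b) (hfi : Integrable f)
    (hfi' : Integrable (deriv f)) (hg : ContDiff ℝ 1 g) {C : ℝ} (hgC : ∀ y, |g y| ≤ C)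
    (hgC' : ∀ y, |deriv g y| ≤ C) :
    ∫ y, (deriv f y * g y + f y * deriv g y) = 0 := by
  have hgc : Continuous g := hg.continuous
  have hgc' : Continuous (deriv g) := hg.continuous_deriv_one
  have hI1 : Integrable fun y => deriv f y * g y :=
    hfi'.mul_bdd hgc.aestronglyMeasurable (.of_forall hgC)
  have hI2 : Integrable fun y => f y * deriv g y :=
    hfi.mul_bdd hgc'.aestronglyMeasurable (.of_forall hgC')
  have hI3 : Integrable fun y => f y * g y :=
    hfi.mul_bdd hgc.aestronglyMeasurable (.of_forall hgC)
  have hlim := intervalIntegral_tendsto_integral (hI1.add hI2) Filter.tendsto_neg_atTop_atBot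
    Filter.tendsto_id
  have heq (T : ℝ) : ∫ y in (-T)..T, (deriv f y * g y + f y * deriv g y) =
      f T * g T - f (-T) * g (-T) :=
    (hf _ _).integral_deriv_mul_eq_sub hg.contDiffOn.absolutelyContinuousOnInterval
  have hI4 : Integrable fun T => f T * g T - f (-T) * g (-T) := hI3.sub hI3.comp_neg
  refine IntegrableAtFilter.eq_zero_of_tendsto (f := fun T => f T * g T - f (-T) * g (-T))
    (l := Filter.atTop) (μ := volume) ⟨Set.univ, Filter.univ_mem, hI4.integrableOn⟩ ?_ ?_
  · intro s hs
    obtain ⟨b, hb⟩ := Filter.mem_atTop_sets.1 hs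
    rw [← top_le_iff, ← Real.volume_Ici (a := b)]
    exact measure_mono hb
  · simpa [heq] using hlim

theorem integral_expI_mul_deriv {f : ℝ → ℝ}
    (hf : ∀ a b, AbsolutelyContinuousOnInterval f a b) (hfi : Integrable f)
    (hfi' : Integrable (deriv f)) (s : ℝ) :
    ∫ y, expI (s * y) * ((deriv f y : ℝ) : ℂ) = -(s * Complex.I) * ∫ y, expI (s * y) * (f y : ℂ) := by
  have hc (y : ℝ) : deriv (fun y => Real.cos (s * y)) y = -s * Real.sin (s * y) := by
    have := ((hasDerivAt_id y).const_mul s).cos.deriv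
    simp only [id, mul_one] at this
    rw [this]; ring
  have hs (y : ℝ) : deriv (fun y => Real.sin (s * y)) y = s * Real.cos (s * y) := by
    have := ((hasDerivAt_id y).const_mul s).sin.deriv
    simp only [id, mul_one] at this
    rw [this]; ring
  -- Integration by parts is available for real functions, so cosine and sine are handled
  -- separately; `1 + |s|` bounds each of them together with its derivative.
  have hb1 (y : ℝ) : |Real.cos (s * y)| ≤ 1 + |s| := by
    linarith [Real.abs_cos_le_one (s * y), abs_nonneg s]
  have hb2 (y : ℝ) : |Real.sin (s * y)| ≤ 1 + |s| := by
    linarith [Real.abs_sin_le_one (s * y), abs_nonneg s]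
  have h1 := integral_deriv_mul_add_mul_deriv_eq_zero hf hfi hfi'
    (g := fun y => Real.cos (s * y)) (by fun_prop) (C := 1 + |s|) hb1 (fun y => by
      rw [hc, abs_mul, abs_neg]
      nlinarith [Real.abs_sin_le_one (s * y), abs_nonneg s])
  have h2 := integral_deriv_mul_add_mul_deriv_eq_zero hf hfi hfi'
    (g := fun y => Real.sin (s * y)) (by fun_prop) (C := 1 + |s|) hb2 (fun y => by
      rw [hs, abs_mul]
      nlinarith [Real.abs_cos_le_one (s * y), abs_nonneg s])
  simp only [hc, hs] at h1 h2
  have hexp (y : ℝ) : expI (s * y) = Real.cos (s * y) + Real.sin (s * y) * Complex.I := by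
    rw [expI, Complex.exp_mul_I, Complex.ofReal_cos, Complex.ofReal_sin]
  have hcc : Continuous fun y => Real.cos (s * y) := by fun_prop
  have hsc : Continuous fun y => Real.sin (s * y) := by fun_prop
  have i1 : Integrable fun y => deriv f y * Real.cos (s * y) :=
    hfi'.mul_bdd hcc.aestronglyMeasurable (.of_forall hb1)
  have i2 : Integrable fun y => deriv f y * Real.sin (s * y) :=
    hfi'.mul_bdd hsc.aestronglyMeasurable (.of_forall hb2)
  have i3 : Integrable fun y => f y * Real.cos (s * y) :=
    hfi.mul_bdd hcc.aestronglyMeasurable (.of_forall hb1)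
  have i4 : Integrable fun y => f y * Real.sin (s * y) :=
    hfi.mul_bdd hsc.aestronglyMeasurable (.of_forall hb2)
  have e1 : ∫ y, expI (s * y) * ((deriv f y : ℝ) : ℂ) =
      ((∫ y, deriv f y * Real.cos (s * y) : ℝ) : ℂ) +
        ((∫ y, deriv f y * Real.sin (s * y) : ℝ) : ℂ) * Complex.I := by
    rw [← integral_complex_ofReal, ← integral_complex_ofReal, ← integral_mul_const, ← integral_add i1.ofReal
      (i2.ofReal.mul_const _)]
    refine integral_congr_ae (.of_forall fun y => ?_)
    simp only [hexp]
    push_cast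
    ring
  have e2 : ∫ y, expI (s * y) * (f y : ℂ) =
      ((∫ y, f y * Real.cos (s * y) : ℝ) : ℂ) +
        ((∫ y, f y * Real.sin (s * y) : ℝ) : ℂ) * Complex.I := by
    rw [← integral_complex_ofReal, ← integral_complex_ofReal, ← integral_mul_const, ← integral_add i3.ofReal
      (i4.ofReal.mul_const _)]
    refine integral_congr_ae (.of_forall fun y => ?_)
    simp only [hexp]
    push_cast
    ring
  have j1 : ∫ y, deriv f y * Real.cos (s * y) = s * ∫ y, f y * Real.sin (s * y) := by
    rw [integral_add i1 ((i4.const_mul (-s)).congr (.of_forall fun y => by ring))] at h1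
    have : ∫ y, f y * (-s * Real.sin (s * y)) = -s * ∫ y, f y * Real.sin (s * y) := by
      rw [← integral_const_mul]
      exact integral_congr_ae (.of_forall fun y => by ring)
    linarith
  have j2 : ∫ y, deriv f y * Real.sin (s * y) = -s * ∫ y, f y * Real.cos (s * y) := by
    rw [integral_add i2 ((i3.const_mul s).congr (.of_forall fun y => by ring))] at h2
    have : ∫ y, f y * (s * Real.cos (s * y)) = s * ∫ y, f y * Real.cos (s * y) := by
      rw [← integral_const_mul]
      exact integral_congr_ae (.of_forall fun y => by ring)
    linarith
  rw [e1, e2, j1, j2]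
  push_cast
  linear_combination ((s : ℂ) * ((∫ y, f y * Real.sin (s * y) : ℝ) : ℂ)) * Complex.I_mul_I

end

end RandomHermitian

/-! ### Products of densities -/

theorem lintegral_fin_prod_eq_prod {α : Type*} [MeasurableSpace α] (ν : Measure α) [SigmaFinite ν]
    (n : ℕ) {f : Fin n → α → ENNReal} (hf : ∀ i, Measurable (f i)) :
    ∫⁻ x : Fin n → α, ∏ i, f i (x i) ∂Measure.pi (fun _ => ν) = ∏ i, ∫⁻ y, f i y ∂ν := by
  induction n with
  | zero => simp
  | succ n ih =>
    have h1 := (measurePreserving_piFinSuccAbove (fun _ : Fin (n + 1) => ν) 0).symm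
    rw [← h1.lintegral_comp_emb (MeasurableEquiv.measurableEmbedding _), Fin.prod_univ_succ,
      ← ih fun i => hf i.succ]
    rw [← lintegral_prod_mul (hf 0).aemeasurable
      (Finset.measurable_prod (f := fun i (x : Fin n → α) => f i.succ (x i)) _ fun i _ =>
        (hf i.succ).comp (measurable_pi_apply i)).aemeasurable]
    refine lintegral_congr fun p => ?_
    simp [MeasurableEquiv.piFinSuccAbove, Fin.insertNthEquiv, Fin.prod_univ_succ]

theorem pi_withDensity_eq {α : Type*} [MeasurableSpace α] (ν : Measure α) [SigmaFinite ν]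
    (n : ℕ) {h : α → ENNReal} (hh : Measurable h) [SigmaFinite (ν.withDensity h)] :
    Measure.pi (fun _ : Fin n => ν.withDensity h) =
      (Measure.pi fun _ : Fin n => ν).withDensity fun x => ∏ i, h (x i) := by
  refine Measure.pi_eq fun s hs => ?_
  have h1 : MeasurableSet (Set.univ.pi s) := MeasurableSet.univ_pi hs
  rw [withDensity_apply _ h1, ← lintegral_indicator h1]
  have h2 (x : Fin n → α) : (Set.univ.pi s).indicator (fun x => ∏ i, h (x i)) x =
      ∏ i, (s i).indicator h (x i) := by
    classical
    by_cases hx : x ∈ Set.univ.pi s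
    · rw [Set.indicator_of_mem hx]
      exact Finset.prod_congr rfl fun i _ => (Set.indicator_of_mem (hx i trivial) h).symm
    · rw [Set.indicator_of_notMem hx]
      simp only [Set.mem_univ_pi, not_forall] at hx
      obtain ⟨i, hi⟩ := hx
      exact (Finset.prod_eq_zero (Finset.mem_univ i) (Set.indicator_of_notMem hi h)).symm
  simp_rw [h2]
  rw [lintegral_fin_prod_eq_prod ν n fun i => hh.indicator (hs i)]
  refine Finset.prod_congr rfl fun i _ => ?_
  rw [lintegral_indicator (hs i), withDensity_apply _ (hs i)]

namespace RandomHermitian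

noncomputable section

/-! ### Complex Gaussian vectors and the moduli of the entries of a row of a unitary matrix -/

/-- The density of the standard exponential distribution. -/
def expDensity (t : ℝ) : ENNReal := (Set.Ioi 0).indicator (fun t => ENNReal.ofReal (Real.exp (-t))) t

theorem measurable_expDensity : Measurable expDensity :=
  (by fun_prop : Measurable fun t : ℝ => ENNReal.ofReal (Real.exp (-t))).indicator measurableSet_Ioi

/-- The density of the standard complex Gaussian distribution. -/
def gaussDensity (z : ℂ) : ENNReal := ENNReal.ofReal (Real.pi⁻¹ * Real.exp (-Complex.normSq z))

theorem measurable_gaussDensity : Measurable gaussDensity := by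
  have h : Continuous fun z : ℂ => Real.pi⁻¹ * Real.exp (-Complex.normSq z) := by
    have := Complex.continuous_normSq
    fun_prop
  exact h.measurable.ennreal_ofReal

theorem lintegral_expDensity : ∫⁻ t, expDensity t = 1 := by
  have h : ∫⁻ t in Set.Ioi (0 : ℝ), ENNReal.ofReal (Real.exp (-t)) = 1 := by
    rw [← ofReal_integral_eq_lintegral_ofReal (integrableOn_exp_neg_Ioi 0)
      (.of_forall fun t => (Real.exp_pos _).le), integral_exp_neg_Ioi_zero, ENNReal.ofReal_one]
  rw [← h, ← lintegral_indicator measurableSet_Ioi]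
  rfl

/-- Polar coordinates and `t = r²`: the angle contributes `2π`, the substitution turns `r dr` into
`dt / 2`, and the factor `π⁻¹` cancels. So the squared modulus of a complex Gaussian is exponential.
-/
theorem lintegral_normSq_gaussDensity {f : ℝ → ENNReal} (hf : Measurable f) :
    ∫⁻ z, gaussDensity z * f (Complex.normSq z) = ∫⁻ t, expDensity t * f t := by
  rw [← Complex.lintegral_comp_polarCoord_symm]
  have h1 (p : ℝ × ℝ) : Complex.normSq (Complex.polarCoord.symm p) = p.1 ^ 2 := by
    rw [Complex.normSq_eq_norm_sq, Complex.norm_polarCoord_symm, sq_abs]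
  simp only [h1, gaussDensity, smul_eq_mul]
  rw [polarCoord_target, Measure.volume_eq_prod, ← Measure.prod_restrict]
  have hm : Measurable fun r : ℝ => ENNReal.ofReal r *
      (ENNReal.ofReal (Real.pi⁻¹ * Real.exp (-r ^ 2)) * f (r ^ 2)) := by
    have := hf.comp (by fun_prop : Measurable fun r : ℝ => r ^ 2)
    simp only [Function.comp_def] at this
    fun_prop
  have h2 := lintegral_prod_mul (μ := (volume : Measure ℝ).restrict (Set.Ioi 0))
    (ν := (volume : Measure ℝ).restrict (Set.Ioo (-Real.pi) Real.pi)) (f := fun r : ℝ =>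
      ENNReal.ofReal r * (ENNReal.ofReal (Real.pi⁻¹ * Real.exp (-r ^ 2)) * f (r ^ 2)))
    (g := fun _ => 1) hm.aemeasurable aemeasurable_const
  simp only [mul_one] at h2
  rw [h2]
  have h3 : ∫⁻ t, expDensity t * f t =
      ∫⁻ t in Set.Ioi (0 : ℝ), ENNReal.ofReal (Real.exp (-t)) * f t := by
    rw [← lintegral_indicator measurableSet_Ioi]
    refine lintegral_congr fun t => ?_
    by_cases ht : t ∈ Set.Ioi (0 : ℝ) <;> simp [expDensity, ht]
  have himg : (fun r : ℝ => r ^ 2) '' Set.Ioi 0 = Set.Ioi 0 := by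
    ext t
    constructor
    · rintro ⟨r, hr, rfl⟩
      exact pow_pos (Set.mem_Ioi.1 hr) 2
    · intro ht
      exact ⟨√t, Real.sqrt_pos.2 ht, Real.sq_sqrt (Set.mem_Ioi.1 ht).le⟩
  have h4 := lintegral_image_eq_lintegral_abs_deriv_mul (s := Set.Ioi (0 : ℝ))
    (f := fun r : ℝ => r ^ 2) (f' := fun r => 2 * r) measurableSet_Ioi
    (fun r _ => by simpa using (hasDerivAt_pow 2 r).hasDerivWithinAt)
    (fun a ha b hb hab => (pow_left_inj₀ (Set.mem_Ioi.1 ha).le (Set.mem_Ioi.1 hb).le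
      two_ne_zero).1 hab)
    (fun t => ENNReal.ofReal (Real.exp (-t)) * f t)
  rw [himg] at h4
  rw [h3, h4, setLIntegral_one, Real.volume_Ioo, ← lintegral_mul_const _ hm]
  refine setLIntegral_congr_fun measurableSet_Ioi fun r hr => ?_
  have hr0 : (0 : ℝ) < r := hr
  have hpi := Real.pi_pos
  rw [← mul_assoc, ← mul_assoc, ← ENNReal.ofReal_mul hr0.le, mul_right_comm,
    ← ENNReal.ofReal_mul (by positivity), ← ENNReal.ofReal_mul (abs_nonneg _),
    abs_of_pos (by positivity)]
  congr 2
  field_simp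
  ring

instance : IsProbabilityMeasure ((volume : Measure ℝ).withDensity expDensity) :=
  ⟨by rw [withDensity_apply _ MeasurableSet.univ, setLIntegral_univ, lintegral_expDensity]⟩

theorem map_normSq_gaussDensity :
    ((volume : Measure ℂ).withDensity gaussDensity).map Complex.normSq =
      (volume : Measure ℝ).withDensity expDensity := by
  ext s hs
  have hm : Measurable Complex.normSq := Complex.continuous_normSq.measurable
  rw [Measure.map_apply hm hs, withDensity_apply _ (hm hs), withDensity_apply _ hs,
    ← lintegral_indicator (hm hs), ← lintegral_indicator hs]
  have h := lintegral_normSq_gaussDensity (f := s.indicator 1) (measurable_one.indicator hs)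
  have h1 (z : ℂ) : (Complex.normSq ⁻¹' s).indicator gaussDensity z =
      gaussDensity z * s.indicator 1 (Complex.normSq z) := by
    by_cases hz : Complex.normSq z ∈ s
    · rw [Set.indicator_of_mem hz, Set.indicator_of_mem (by exact hz)]; simp
    · rw [Set.indicator_of_notMem hz, Set.indicator_of_notMem (by exact hz)]; simp
  have h2 (t : ℝ) : s.indicator expDensity t = expDensity t * s.indicator 1 t := by
    by_cases hz : t ∈ s <;> simp [hz]
  simp_rw [h1, h2]
  exact h

instance : IsProbabilityMeasure ((volume : Measure ℂ).withDensity gaussDensity) := by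
  have hm : Measurable Complex.normSq := Complex.continuous_normSq.measurable
  refine ⟨?_⟩
  have h : (((volume : Measure ℂ).withDensity gaussDensity).map Complex.normSq) Set.univ = 1 := by
    rw [map_normSq_gaussDensity, measure_univ]
  rwa [Measure.map_apply hm MeasurableSet.univ, Set.preimage_univ] at h

/-- The standard Gaussian measure on `ℂⁿ`. -/
def gaussC (n : ℕ) : Measure (Fin n → ℂ) :=
  Measure.pi fun _ => (volume : Measure ℂ).withDensity gaussDensity

instance (n : ℕ) : IsProbabilityMeasure (gaussC n) :=
  inferInstanceAs (IsProbabilityMeasure (Measure.pi _))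

theorem measurePreserving_normSq_gaussC (n : ℕ) :
    MeasurePreserving (fun g : Fin n → ℂ => fun k => Complex.normSq (g k)) (gaussC n)
      ((volume : Measure (Fin n → ℝ)).withDensity fun x => ∏ i, expDensity (x i)) := by
  have h := measurePreserving_pi (fun _ : Fin n => (volume : Measure ℂ).withDensity gaussDensity)
    (fun _ : Fin n => (volume : Measure ℝ).withDensity expDensity)
    (f := fun _ => Complex.normSq)
    (fun _ => ⟨Complex.continuous_normSq.measurable, map_normSq_gaussDensity⟩)
  rw [pi_withDensity_eq volume n measurable_expDensity] at h
  exact h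

theorem sum_normSq_vecMul {n : ℕ} (U : UG n) (g : Fin n → ℂ) :
    ∑ k, Complex.normSq ((g ᵥ* U.1) k) = ∑ k, Complex.normSq (g k) := by
  have h (a : Fin n → ℂ) : ((∑ k, Complex.normSq (a k) : ℝ) : ℂ) = a ⬝ᵥ star a := by
    simp only [dotProduct, Complex.ofReal_sum]
    exact Finset.sum_congr rfl fun k _ => (Complex.mul_conj _).symm
  have h2 : ((∑ k, Complex.normSq ((g ᵥ* U.1) k) : ℝ) : ℂ) =
      ((∑ k, Complex.normSq (g k) : ℝ) : ℂ) := by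
    rw [h, h, Matrix.star_vecMul, ← Matrix.dotProduct_mulVec, Matrix.mulVec_mulVec]
    have : U.1 * U.1ᴴ = 1 := Unitary.coe_mul_star_self U
    rw [this, Matrix.one_mulVec]
  exact_mod_cast h2

theorem measurePreserving_vecMul_volume {n : ℕ} (U : UG n) :
    MeasurePreserving (fun g : Fin n → ℂ => g ᵥ* U.1) := by
  -- The real determinant of a complex linear map is the squared modulus of its complex determinant,
  -- which is `1` for a unitary matrix.
  have hdet : LinearMap.det ((Matrix.toLin' U.1ᵀ).restrictScalars ℝ) = 1 := by
    rw [LinearMap.det_restrictScalars, LinearMap.det_toLin', Matrix.det_transpose,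
      Algebra.norm_complex_apply]
    have h : U.1.det * star U.1.det = 1 := by
      have h1 : U.1 * U.1ᴴ = 1 := Unitary.coe_mul_star_self U
      rw [← Matrix.det_conjTranspose, ← Matrix.det_mul, h1, Matrix.det_one]
    have h2 : ((Complex.normSq U.1.det : ℝ) : ℂ) = 1 := by
      rw [← h, ← Complex.mul_conj]
      rfl
    exact_mod_cast h2
  have hmap := Measure.map_linearMap_addHaar_eq_smul_addHaar (volume : Measure (Fin n → ℂ))
    (f := (Matrix.toLin' U.1ᵀ).restrictScalars ℝ) (by rw [hdet]; exact one_ne_zero)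
  rw [hdet] at hmap
  have hfun : (fun g : Fin n → ℂ => g ᵥ* U.1) =
      ((Matrix.toLin' U.1ᵀ).restrictScalars ℝ : (Fin n → ℂ) → Fin n → ℂ) := by
    ext1 g
    simp [Matrix.mulVec_transpose]
  refine ⟨?_, ?_⟩
  · exact (Continuous.matrix_vecMul continuous_id continuous_const).measurable
  · rw [hfun, hmap]
    simp

theorem gaussC_eq_withDensity (n : ℕ) : gaussC n = (volume : Measure (Fin n → ℂ)).withDensity
    fun g => ENNReal.ofReal (Real.pi⁻¹ ^ n * Real.exp (-∑ k, Complex.normSq (g k))) := by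
  rw [gaussC, pi_withDensity_eq volume n measurable_gaussDensity]
  congr 1
  ext g
  simp only [gaussDensity]
  rw [← ENNReal.ofReal_prod_of_nonneg fun i _ => by positivity, Finset.prod_mul_distrib,
    ← Real.exp_sum, Finset.sum_neg_distrib]
  simp

theorem measurePreserving_vecMul_gaussC {n : ℕ} (U : UG n) :
    MeasurePreserving (fun g : Fin n → ℂ => g ᵥ* U.1) (gaussC n) (gaussC n) := by
  have hv := measurePreserving_vecMul_volume U
  refine ⟨hv.measurable, ?_⟩
  have hd : Measurable fun g : Fin n → ℂ =>
      ENNReal.ofReal (Real.pi⁻¹ ^ n * Real.exp (-∑ k, Complex.normSq (g k))) := by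
    have := Complex.continuous_normSq
    exact (by fun_prop : Continuous fun g : Fin n → ℂ =>
      Real.pi⁻¹ ^ n * Real.exp (-∑ k, Complex.normSq (g k))).measurable.ennreal_ofReal
  ext s hs
  rw [Measure.map_apply hv.measurable hs, gaussC_eq_withDensity, withDensity_apply _ hs,
    withDensity_apply _ (hv.measurable hs), ← hv.setLIntegral_comp_preimage hs hd]
  simp_rw [sum_normSq_vecMul]

theorem exists_unitary_row {m : ℕ} {e : Fin (m + 1) → ℂ}
    (he : ∑ k, Complex.normSq (e k) = 1) : ∃ U : UG (m + 1), ∀ k, U.1 0 k = e k := by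
  have hnorm : ‖(WithLp.toLp 2 e : EuclideanSpace ℂ (Fin (m + 1)))‖ = 1 := by
    rw [EuclideanSpace.norm_eq]
    simp only [← Complex.normSq_eq_norm_sq]
    rw [he, Real.sqrt_one]
  obtain ⟨b, hb⟩ := Orthonormal.exists_orthonormalBasis_extension_of_card_eq
    (𝕜 := ℂ) (E := EuclideanSpace ℂ (Fin (m + 1))) (ι := Fin (m + 1)) (by simp)
    (v := fun _ => WithLp.toLp 2 e) (s := {0}) (by
      refine ⟨fun i => hnorm, fun i j hij => ?_⟩
      exact absurd (Subsingleton.elim i j) hij)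
  refine ⟨⟨Matrix.of fun i k => b i k, ?_⟩, fun k => ?_⟩
  · rw [Matrix.mem_unitaryGroup_iff]
    ext i j
    rw [Matrix.mul_apply, Matrix.one_apply]
    have h := orthonormal_iff_ite.1 b.orthonormal j i
    rw [PiLp.inner_apply] at h
    simp only [Matrix.of_apply, Matrix.star_apply]
    rw [show (if i = j then (1 : ℂ) else 0) = if j = i then 1 else 0 by simp [eq_comm], ← h]
    rfl
  · have := hb 0 rfl
    simp [this]

/-- For nonzero `g`, the vector `g / |g|` is the first row of some unitary `V`, and left invariance
replaces the first row of `U` by that of `V U`, namely `g U / |g|`. Averaging over Gaussian `g` and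
exchanging integrals, `g U` has the law of `g` for each `U`, so the squared moduli become normalized
independent exponentials. -/
theorem lintegral_haarU_row {m : ℕ} {f : (Fin (m + 1) → ℝ) → ENNReal} (hf : Measurable f) :
    ∫⁻ U, f (fun k => Complex.normSq (U.1 0 k)) ∂haarU (m + 1) =
      ∫⁻ x, f (fun k => x k / ∑ l, x l)
        ∂((volume : Measure (Fin (m + 1) → ℝ)).withDensity fun x => ∏ i, expDensity (x i)) := by
  let ψ : (Fin (m + 1) → ℂ) → ENNReal := fun g =>
    f (fun k => Complex.normSq (g k) / ∑ l, Complex.normSq (g l))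
  have hq : Measurable fun x : Fin (m + 1) → ℝ => fun k => x k / ∑ l, x l := by fun_prop
  have hns : Measurable Complex.normSq := Complex.continuous_normSq.measurable
  have hψ : Measurable ψ := hf.comp (by fun_prop)
  have hgauss0 : ∀ᵐ g ∂gaussC (m + 1), g ≠ 0 := by
    rw [gaussC_eq_withDensity]
    refine (withDensity_absolutelyContinuous _ _).ae_le ?_
    exact Measure.ae_ne volume 0
  have h1 (g : Fin (m + 1) → ℂ) (hg : g ≠ 0) :
      ∫⁻ U, f (fun k => Complex.normSq (U.1 0 k)) ∂haarU (m + 1) =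
        ∫⁻ U, ψ (g ᵥ* U.1) ∂haarU (m + 1) := by
    have hpos : 0 < ∑ k, Complex.normSq (g k) := by
      obtain ⟨k, hk⟩ := Function.ne_iff.1 hg
      exact Finset.sum_pos' (fun i _ => Complex.normSq_nonneg _)
        ⟨k, Finset.mem_univ _, Complex.normSq_pos.2 hk⟩
    set r := ∑ k, Complex.normSq (g k) with hr
    have hnr : Complex.normSq ((√r : ℝ) : ℂ) = r := by
      rw [Complex.normSq_ofReal, Real.mul_self_sqrt hpos.le]
    obtain ⟨V, hV⟩ := exists_unitary_row (e := fun k => g k / (√r : ℝ)) (by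
      simp_rw [map_div₀, hnr, ← Finset.sum_div]
      exact div_self hpos.ne')
    rw [← lintegral_mul_left_eq_self (μ := haarU (m + 1))
      (fun U => f (fun k => Complex.normSq (U.1 0 k))) V]
    refine lintegral_congr fun U => ?_
    simp only [ψ, sum_normSq_vecMul]
    congr 1
    ext k
    have h2 : (V * U).1 0 k = (g ᵥ* U.1) k / (√r : ℝ) := by
      change (V.1 * U.1) 0 k = _
      rw [Matrix.mul_apply, Matrix.vecMul, dotProduct, Finset.sum_div]
      refine Finset.sum_congr rfl fun j _ => ?_
      rw [hV j]
      ring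
    rw [h2, map_div₀, hnr]
  have h3 : ∫⁻ U, f (fun k => Complex.normSq (U.1 0 k)) ∂haarU (m + 1) =
      ∫⁻ g, ∫⁻ U, ψ (g ᵥ* U.1) ∂haarU (m + 1) ∂gaussC (m + 1) := by
    rw [← lintegral_congr_ae (hgauss0.mono h1)]
    simp
  rw [h3, lintegral_lintegral_swap]
  · have h4 (U : UG (m + 1)) : ∫⁻ g, ψ (g ᵥ* U.1) ∂gaussC (m + 1) = ∫⁻ g, ψ g ∂gaussC (m + 1) :=
      (measurePreserving_vecMul_gaussC U).lintegral_comp hψ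
    simp_rw [h4]
    simp only [lintegral_const, measure_univ, mul_one]
    exact (measurePreserving_normSq_gaussC (m + 1)).lintegral_comp (hf.comp hq)
  · refine (hψ.comp (Continuous.measurable ?_)).aemeasurable
    exact Continuous.matrix_vecMul continuous_fst (continuous_subtype_val.comp continuous_snd)

/-! ### The secular equation and interlacing -/

section Secular

open Polynomial

variable {m : ℕ}

/-- The product `∏_{l ≠ k} (x_k - x_l)`. -/
def gapProd (x : Fin (m + 1) → ℝ) (k : Fin (m + 1)) : ℝ := ∏ l : Fin m, (x k - x (k.succAbove l))

/-- The polynomial `∑_k E_k ∏_{l ≠ k} (X - x_l)`. -/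
def secularPoly (x E : Fin (m + 1) → ℝ) : ℝ[X] :=
  ∑ k, C (E k) * ∏ l : Fin m, (X - C (x (k.succAbove l)))

/-- The weights for which the secular polynomial has roots `y`. -/
def secularCoord (x : Fin (m + 1) → ℝ) (y : Fin m → ℝ) (k : Fin (m + 1)) : ℝ :=
  (∏ l, (x k - y l)) / gapProd x k

/-- The tuples `y` with `x_j < y_j < x_{j+1}`. -/
def interlacing (x : Fin (m + 1) → ℝ) : Set (Fin m → ℝ) :=
  Set.univ.pi fun j => Set.Ioo (x j.castSucc) (x j.succ)

theorem mem_interlacing {x : Fin (m + 1) → ℝ} {y : Fin m → ℝ} :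
    y ∈ interlacing x ↔ ∀ j, x j.castSucc < y j ∧ y j < x j.succ := by
  simp [interlacing]

theorem gapProd_ne_zero {x : Fin (m + 1) → ℝ} (hx : Function.Injective x) (k : Fin (m + 1)) :
    gapProd x k ≠ 0 :=
  Finset.prod_ne_zero_iff.2 fun l _ => sub_ne_zero.2 fun h =>
    Fin.succAbove_ne k l (hx h).symm

theorem eval_secularPoly (x E : Fin (m + 1) → ℝ) (i : Fin (m + 1)) :
    (secularPoly x E).eval (x i) = E i * gapProd x i := by
  rw [secularPoly, eval_finsetSum, Finset.sum_eq_single i]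
  · simp [gapProd, eval_prod]
  · intro k _ hk
    obtain ⟨l, hl⟩ := Fin.exists_succAbove_eq hk.symm
    rw [eval_mul, eval_prod, Finset.prod_eq_zero (Finset.mem_univ l), mul_zero]
    simp [hl]
  · simp

theorem natDegree_secularPoly_le (x E : Fin (m + 1) → ℝ) : (secularPoly x E).natDegree ≤ m := by
  refine natDegree_sum_le_of_forall_le _ _ fun k _ => ?_
  refine (natDegree_C_mul_le _ _).trans ?_
  rw [natDegree_finsetProd_X_sub_C_eq_card]
  simp

theorem coeff_prod_X_sub_C_card (y : Fin m → ℝ) : (∏ l, (X - C (y l))).coeff m = 1 := by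
  have h := (monic_prod_X_sub_C y Finset.univ).coeff_natDegree
  rwa [natDegree_finsetProd_X_sub_C_eq_card, Finset.card_univ, Fintype.card_fin] at h

theorem coeff_secularPoly (x E : Fin (m + 1) → ℝ) : (secularPoly x E).coeff m = ∑ k, E k := by
  rw [secularPoly, finsetSum_coeff]
  refine Finset.sum_congr rfl fun k _ => ?_
  rw [coeff_C_mul, coeff_prod_X_sub_C_card, mul_one]

theorem natDegree_C_mul_prod_le (r : ℝ) (y : Fin m → ℝ) :
    (C r * ∏ l, (X - C (y l))).natDegree ≤ m := by
  refine (natDegree_C_mul_le _ _).trans ?_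
  rw [natDegree_finsetProd_X_sub_C_eq_card]
  simp

/-- Lagrange interpolation: both sides have degree at most `m` and agree at the `m + 1` nodes `x i`.
-/
theorem secularPoly_mul_secularCoord {x : Fin (m + 1) → ℝ} (hx : Function.Injective x) (r : ℝ)
    (y : Fin m → ℝ) :
    secularPoly x (fun k => r * secularCoord x y k) = C r * ∏ l, (X - C (y l)) := by
  refine eq_of_degrees_lt_of_eval_index_eq (v := x) Finset.univ hx.injOn ?_ ?_ fun i _ => ?_
  · rw [Finset.card_univ, Fintype.card_fin]
    exact (degree_le_of_natDegree_le (natDegree_secularPoly_le _ _)).trans_lt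
      (by exact_mod_cast Nat.lt_succ_self m)
  · rw [Finset.card_univ, Fintype.card_fin]
    exact (degree_le_of_natDegree_le (natDegree_C_mul_prod_le _ _)).trans_lt
      (by exact_mod_cast Nat.lt_succ_self m)
  · rw [eval_secularPoly, secularCoord, eval_mul, eval_prod]
    simp only [eval_C, eval_sub, eval_X]
    field_simp [gapProd_ne_zero hx i]

theorem sum_secularCoord {x : Fin (m + 1) → ℝ} (hx : Function.Injective x) (y : Fin m → ℝ) :
    ∑ k, secularCoord x y k = 1 := by
  have h := congrArg (fun p => p.coeff m) (secularPoly_mul_secularCoord hx 1 y)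
  simpa [coeff_secularPoly, coeff_prod_X_sub_C_card] using h

/-- Interlacing gives `x k - y l` the same sign as `x k - x (k.succAbove l)`, so the quotient is
positive factor by factor. -/
theorem secularCoord_pos {x : Fin (m + 1) → ℝ} (hx : StrictMono x) {y : Fin m → ℝ}
    (hy : y ∈ interlacing x) (k : Fin (m + 1)) : 0 < secularCoord x y k := by
  rw [mem_interlacing] at hy
  rw [secularCoord, gapProd, ← Finset.prod_div_distrib]
  refine Finset.prod_pos fun l _ => ?_
  obtain h | h := lt_or_ge l.castSucc k
  · rw [Fin.succAbove_of_castSucc_lt _ _ h]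
    have h1 : x l.succ ≤ x k := hx.monotone (Fin.castSucc_lt_iff_succ_le.1 h)
    exact div_pos (sub_pos.2 ((hy l).2.trans_le h1)) (sub_pos.2 (hx h))
  · rw [Fin.succAbove_of_le_castSucc _ _ h]
    have h1 : x k ≤ x l.castSucc := hx.monotone h
    exact div_pos_of_neg_of_neg (sub_neg.2 (h1.trans_lt (hy l).1))
      (sub_neg.2 (hx (h.trans_lt (Fin.castSucc_lt_succ))))

/-- The coordinates determine the monic polynomial with roots `y`, and the disjoint gaps of `x` fix
the labelling of the roots. -/
theorem injOn_secularCoord {x : Fin (m + 1) → ℝ} (hx : StrictMono x) :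
    Set.InjOn (secularCoord x) (interlacing x) := by
  intro y hy y' hy' h
  have h1 := secularPoly_mul_secularCoord hx.injective 1 y
  rw [h, secularPoly_mul_secularCoord hx.injective 1 y'] at h1
  rw [mem_interlacing] at hy hy'
  ext j
  have h2 := congrArg (fun p => p.eval (y j)) h1.symm
  simp only [C_1, one_mul, eval_prod, eval_sub, eval_X, eval_C] at h2
  rw [Finset.prod_eq_zero (Finset.mem_univ j) (sub_self (y j)), eq_comm,
    Finset.prod_eq_zero_iff] at h2
  obtain ⟨l, -, hl⟩ := h2
  have hl' : y j = y' l := sub_eq_zero.1 hl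
  obtain h3 | h3 | h3 := lt_trichotomy j l
  · have : x j.succ ≤ x l.castSucc := hx.monotone (Fin.succ_le_castSucc_iff.2 h3)
    linarith [(hy j).2, (hy' l).1]
  · rw [hl', h3]
  · have : x l.succ ≤ x j.castSucc := hx.monotone (Fin.succ_le_castSucc_iff.2 h3)
    linarith [(hy j).1, (hy' l).2]

/-- Compared with the midpoints `y`: `secularCoord_pos` ties the sign of each gap product to that of
`∏ (x k - y l)`, and of all the `y l` only `y j` separates the two neighbouring nodes. -/
theorem gapProd_mul_gapProd_neg {x : Fin (m + 1) → ℝ} (hx : StrictMono x) (j : Fin m) :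
    gapProd x j.castSucc * gapProd x j.succ < 0 := by
  let y : Fin m → ℝ := fun j => (x j.castSucc + x j.succ) / 2
  have hlt (j : Fin m) : x j.castSucc < x j.succ := hx Fin.castSucc_lt_succ
  have hy : y ∈ interlacing x := mem_interlacing.2 fun j => by
    constructor <;> simp only [y] <;> linarith [hlt j]
  have h1 := mul_pos (secularCoord_pos hx hy j.castSucc) (secularCoord_pos hx hy j.succ)
  rw [mem_interlacing] at hy
  have h2 : (∏ l, (x j.castSucc - y l)) * ∏ l, (x j.succ - y l) < 0 := by
    rw [← Finset.prod_mul_distrib, ← Finset.mul_prod_erase _ _ (Finset.mem_univ j)]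
    refine mul_neg_of_neg_of_pos (mul_neg_of_neg_of_pos (sub_neg.2 (hy j).1) (sub_pos.2 (hy j).2))
      (Finset.prod_pos fun l hl => ?_)
    obtain h3 | h3 := lt_or_gt_of_ne (Finset.ne_of_mem_erase hl)
    · have : x l.succ ≤ x j.castSucc := hx.monotone (Fin.succ_le_castSucc_iff.2 h3)
      exact mul_pos (by linarith [(hy l).2]) (by linarith [(hy l).2, hlt j])
    · have : x j.succ ≤ x l.castSucc := hx.monotone (Fin.succ_le_castSucc_iff.2 h3)
      exact mul_pos_of_neg_of_neg (by linarith [(hy l).1, hlt j]) (by linarith [(hy l).1])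
  rw [secularCoord, secularCoord, div_mul_div_comm] at h1
  exact ((div_pos_iff.1 h1).resolve_left fun h => absurd h.1 h2.le.not_gt).2

/-- With positive weights the secular polynomial alternates in sign at the nodes, so each gap
contains a root. These `m` roots and the coefficient `∑ E l` of degree `m` determine the polynomial.
-/
theorem exists_interlacing_of_pos {x : Fin (m + 1) → ℝ} (hx : StrictMono x)
    {E : Fin (m + 1) → ℝ} (hE : ∀ k, 0 < E k) :
    ∃ y ∈ interlacing x, ∀ k, E k = (∑ l, E l) * secularCoord x y k := by
  have hroot (j : Fin m) : ∃ t ∈ Set.Ioo (x j.castSucc) (x j.succ),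
      (secularPoly x E).eval t = 0 := by
    have hle : x j.castSucc ≤ x j.succ := (hx Fin.castSucc_lt_succ).le
    have hc : ContinuousOn (fun t => (secularPoly x E).eval t)
        (Set.Icc (x j.castSucc) (x j.succ)) := (secularPoly x E).continuous.continuousOn
    have hneg : (secularPoly x E).eval (x j.castSucc) * (secularPoly x E).eval (x j.succ) < 0 := by
      rw [eval_secularPoly, eval_secularPoly, mul_mul_mul_comm]
      exact mul_neg_of_pos_of_neg (mul_pos (hE _) (hE _)) (gapProd_mul_gapProd_neg hx j)
    obtain h | h := mul_neg_iff.1 hneg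
    · exact intermediate_value_Ioo' hle hc ⟨h.2, h.1⟩
    · exact intermediate_value_Ioo hle hc ⟨h.1, h.2⟩
  choose y hy hroot using hroot
  refine ⟨y, fun j _ => hy j, ?_⟩
  have hyI : y ∈ interlacing x := fun j _ => hy j
  have hinj : Function.Injective y := by
    refine StrictMono.injective fun j l hjl => ?_
    have : x j.succ ≤ x l.castSucc := hx.monotone (Fin.succ_le_castSucc_iff.2 hjl)
    exact (hy j).2.trans (this.trans_lt (hy l).1)
  have hpoly : secularPoly x E = C (∑ l, E l) * ∏ l, (X - C (y l)) := by
    refine eq_of_degree_sub_lt_of_eval_index_eq (v := y) Finset.univ hinj.injOn ?_ fun j _ => ?_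
    · rw [Finset.card_univ, Fintype.card_fin, degree_lt_iff_coeff_zero]
      intro i hi
      rw [coeff_sub]
      obtain rfl | hi := hi.eq_or_lt
      · rw [coeff_secularPoly, coeff_C_mul, coeff_prod_X_sub_C_card, mul_one, sub_self]
      · rw [coeff_eq_zero_of_natDegree_lt ((natDegree_secularPoly_le x E).trans_lt hi),
          coeff_eq_zero_of_natDegree_lt ((natDegree_C_mul_prod_le _ y).trans_lt hi), sub_self]
    · rw [hroot, eval_mul, eval_prod, Finset.prod_eq_zero (Finset.mem_univ j), mul_zero]
      simp
  intro k
  have h := congrArg (fun p => p.eval (x k)) hpoly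
  simp only [eval_secularPoly, eval_mul, eval_C, eval_prod, eval_sub, eval_X] at h
  rw [secularCoord, ← mul_div_assoc, ← h, mul_div_cancel_right₀ _ (gapProd_ne_zero hx.injective k)]

/-! ### The Jacobian of the secular coordinates -/

theorem vandermondeDet_eq_prod {n : ℕ} (x : Fin n → ℝ) :
    vandermondeDet x = ∏ i, ∏ j ∈ Finset.Ioi i, (x j - x i) := Matrix.det_vandermonde x

theorem prod_erase_abs_sub {n : ℕ} (x : Fin n → ℝ) :
    ∏ k, ∏ l ∈ Finset.univ.erase k, |x k - x l| = |vandermondeDet x| ^ 2 := by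
  have h1 (k : Fin n) : ∏ l ∈ Finset.univ.erase k, |x k - x l| =
      (∏ l ∈ Finset.Ioi k, |x k - x l|) * ∏ l ∈ Finset.Iio k, |x k - x l| := by
    rw [← Finset.prod_union]
    · congr 1
      ext l
      simp [lt_or_lt_iff_ne, eq_comm]
    · rw [Finset.disjoint_left]
      intro l hl hl'
      exact lt_asymm (Finset.mem_Ioi.1 hl) (Finset.mem_Iio.1 hl')
  have h2 : ∏ k, ∏ l ∈ Finset.Iio k, |x k - x l| = ∏ k, ∏ l ∈ Finset.Ioi k, |x k - x l| := by
    rw [Finset.prod_comm' (t' := Finset.univ) (s' := fun l => Finset.Ioi l) (by simp)]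
    simp_rw [abs_sub_comm]
  simp_rw [h1, Finset.prod_mul_distrib, h2, vandermondeDet_eq_prod, Finset.abs_prod, pow_two,
    abs_sub_comm]

theorem prod_abs_gapProd (x : Fin (m + 1) → ℝ) :
    ∏ k, |gapProd x k| = |vandermondeDet x| ^ 2 := by
  rw [← prod_erase_abs_sub]
  refine Finset.prod_congr rfl fun k _ => ?_
  rw [gapProd, Finset.abs_prod, ← Finset.compl_singleton, ← Fin.image_succAbove_univ,
    Finset.prod_image fun a _ b _ h => Fin.succAbove_right_injective h]

/-- The polynomials `∏_l (X - y_l)` and `∏_{l ≠ j} (X - y_l)`. -/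
def deletedPoly (y : Fin m → ℝ) : Fin (m + 1) → ℝ[X] :=
  Fin.cons (∏ l, (X - C (y l))) fun j => ∏ l ∈ Finset.univ.erase j, (X - C (y l))

theorem deletedPoly_zero (y : Fin m → ℝ) : deletedPoly y 0 = ∏ l, (X - C (y l)) := rfl

theorem deletedPoly_succ (y : Fin m → ℝ) (j : Fin m) :
    deletedPoly y j.succ = ∏ l ∈ Finset.univ.erase j, (X - C (y l)) := rfl

/-- Evaluating polynomials of degree at most `m` is multiplying their coefficient matrix by a
Vandermonde matrix. -/
theorem det_eval_deletedPoly (y : Fin m → ℝ) (p : Fin (m + 1) → ℝ) :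
    (Matrix.of fun k j => (deletedPoly y j).eval (p k)).det =
      vandermondeDet p * (Matrix.of fun i j : Fin (m + 1) => (deletedPoly y j).coeff i).det := by
  rw [vandermondeDet, ← Matrix.det_mul]
  congr 1
  ext k j
  have hdeg : (deletedPoly y j).natDegree < m + 1 := by
    refine Fin.cases ?_ (fun j => ?_) j
    · simp [deletedPoly]
    · simp only [deletedPoly, Fin.cons_succ]
      rw [natDegree_finsetProd_X_sub_C_eq_card]
      refine (Finset.card_le_univ _).trans_lt ?_
      simp
  rw [Matrix.of_apply, eval_eq_sum_range' hdeg, Matrix.mul_apply, ← Fin.sum_univ_eq_sum_range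
    (fun i => (deletedPoly y j).coeff i * p k ^ i)]
  exact Finset.sum_congr rfl fun i _ => by simp [Matrix.vandermonde_apply, mul_comm]

/-- Evaluation at the nodes `(z, y)`, with `z` an auxiliary point off `y`, makes the matrix block
triangular with a diagonal block. Comparing with `det_eval_deletedPoly` cancels `∏ |z - y l|` and
one factor `|Δ(y)|`. -/
theorem abs_det_coeff_deletedPoly {y : Fin m → ℝ} (hy : Function.Injective y) :
    |(Matrix.of fun i j : Fin (m + 1) => (deletedPoly y j).coeff i).det| = |vandermondeDet y| := by
  obtain ⟨z, hz⟩ : ∃ z, ∀ l, z ≠ y l := by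
    obtain ⟨z, hz⟩ := (Set.finite_range y).exists_notMem
    exact ⟨z, fun l h => hz ⟨l, h.symm⟩⟩
  have h1 := congrArg abs (det_eval_deletedPoly y (Fin.cons z y))
  rw [Matrix.det_succ_column_zero, Finset.sum_eq_single 0, vandermondeDet_cons, abs_mul,
    abs_mul] at h1
  · have h2 : ((Matrix.of fun k j => (deletedPoly y j).eval
        ((Fin.cons z y : Fin (m + 1) → ℝ) k)).submatrix (Fin.succAbove 0) Fin.succ) =
        Matrix.diagonal fun j => ∏ l ∈ Finset.univ.erase j, (y j - y l) := by
      ext i j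
      simp only [Matrix.submatrix_apply, Matrix.of_apply, Fin.succAbove_zero, Fin.cons_succ,
        deletedPoly_succ, eval_prod, eval_sub, eval_X, eval_C]
      obtain rfl | hij := eq_or_ne i j
      · rw [Matrix.diagonal_apply_eq]
      · rw [Matrix.diagonal_apply_ne _ hij]
        exact Finset.prod_eq_zero (Finset.mem_erase.2 ⟨hij, Finset.mem_univ i⟩) (sub_self _)
    rw [h2, Matrix.det_diagonal] at h1
    simp only [Matrix.of_apply, Fin.cons_zero, deletedPoly_zero, eval_prod, eval_sub,
      eval_X, eval_C, Fin.val_zero, pow_zero, abs_one, one_mul, Finset.abs_prod] at h1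
    rw [prod_erase_abs_sub, pow_two] at h1
    have h3 : ∏ l, |z - y l| ≠ 0 :=
      Finset.prod_ne_zero_iff.2 fun l _ => abs_ne_zero.2 (sub_ne_zero.2 (hz l))
    have h4 : |vandermondeDet y| ≠ 0 := abs_ne_zero.2 (Matrix.det_vandermonde_ne_zero_iff.2 hy)
    have h5 : ∏ l, |y l - z| = ∏ l, |z - y l| := Finset.prod_congr rfl fun l _ => abs_sub_comm _ _
    rw [abs_mul, abs_mul, Finset.abs_prod, h5, mul_assoc] at h1
    exact (mul_left_cancel₀ h4 (mul_left_cancel₀ h3 h1)).symm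
  · intro i _ hi
    obtain ⟨i, rfl⟩ := Fin.exists_succ_eq.2 hi
    simp only [Matrix.of_apply, Fin.cons_succ, deletedPoly_zero, eval_prod, eval_sub,
      eval_X, eval_C]
    rw [Finset.prod_eq_zero (Finset.mem_univ i) (sub_self _), mul_zero, zero_mul]
  · simp

/-- The Jacobian matrix of `(r, y) ↦ r • secularCoord x y`. -/
def secularJacobian (x q : Fin (m + 1) → ℝ) : Matrix (Fin (m + 1)) (Fin (m + 1)) ℝ :=
  Matrix.of fun k => Fin.cons (secularCoord x (Fin.tail q) k) fun j =>
    -(q 0 * (∏ l ∈ Finset.univ.erase j, (x k - Fin.tail q l)) / gapProd x k)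

/-- Rows carry `1 / gapProd x k` and all columns but the first carry `-q 0`; what remains is the
evaluation matrix of `deletedPoly`. The gap products contribute `|Δ(x)|⁻²`, the evaluation matrix
`|Δ(x)| |Δ(y)|`. -/
theorem abs_det_secularJacobian {x q : Fin (m + 1) → ℝ} (hx : Function.Injective x)
    (hq : Function.Injective (Fin.tail q)) :
    |(secularJacobian x q).det| =
      |q 0| ^ m * (|vandermondeDet (Fin.tail q)| / |vandermondeDet x|) := by
  have h1 : secularJacobian x q = Matrix.diagonal (fun k => (gapProd x k)⁻¹) *
      (Matrix.of fun k j => (deletedPoly (Fin.tail q) j).eval (x k)) *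
      Matrix.diagonal (Fin.cons 1 fun _ => -q 0) := by
    ext k j
    rw [Matrix.mul_diagonal, Matrix.diagonal_mul]
    refine Fin.cases ?_ (fun j => ?_) j
    · simp [secularJacobian, deletedPoly, eval_prod, secularCoord, div_eq_inv_mul]
    · simp only [secularJacobian, deletedPoly, Matrix.of_apply, Fin.cons_succ, eval_prod, eval_sub,
        eval_X, eval_C]
      ring
  have h2 : |vandermondeDet x| ≠ 0 := abs_ne_zero.2 (Matrix.det_vandermonde_ne_zero_iff.2 hx)
  have h3 : ∏ i, |(Fin.cons 1 fun _ => -q 0 : Fin (m + 1) → ℝ) i| = |q 0| ^ m := by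
    rw [Fin.prod_univ_succ]
    simp
  rw [h1, Matrix.det_mul, Matrix.det_mul, Matrix.det_diagonal, Matrix.det_diagonal,
    det_eval_deletedPoly, abs_mul, abs_mul, abs_mul, abs_det_coeff_deletedPoly hq,
    Finset.abs_prod, Finset.abs_prod, h3]
  simp only [abs_inv, Finset.prod_inv_distrib, prod_abs_gapProd]
  field_simp

theorem hasFDerivAt_secular (x q : Fin (m + 1) → ℝ) :
    HasFDerivAt (fun q : Fin (m + 1) → ℝ => fun k => q 0 * secularCoord x (Fin.tail q) k)
      (LinearMap.toContinuousLinearMap (Matrix.toLin' (secularJacobian x q))) q := by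
  rw [hasFDerivAt_pi']
  intro k
  let π (i : Fin (m + 1)) : (Fin (m + 1) → ℝ) →L[ℝ] ℝ := ContinuousLinearMap.proj i
  have h1 (l : Fin m) : HasFDerivAt (fun q : Fin (m + 1) → ℝ => x k - q l.succ) (-(π l.succ)) q :=
    (π l.succ).hasFDerivAt.const_sub (x k)
  have h2 := HasFDerivAt.finsetProd (u := Finset.univ) (fun l _ => h1 l)
  have h3 := ((π 0).hasFDerivAt (x := q)).mul (h2.mul_const (gapProd x k)⁻¹)
  refine h3.congr_fderiv ?_ |>.congr_of_eventuallyEq (.of_forall fun q => ?_)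
  · ext1 v
    have e1 : (ContinuousLinearMap.proj k ∘SL
        LinearMap.toContinuousLinearMap (Matrix.toLin' (secularJacobian x q))) v =
          (secularJacobian x q *ᵥ v) k := rfl
    have e2 (i : Fin (m + 1)) (v : Fin (m + 1) → ℝ) : π i v = v i := rfl
    rw [e1, Matrix.mulVec, dotProduct, Fin.sum_univ_succ]
    simp only [add_apply, smul_apply, sum_apply, neg_apply, e2, smul_eq_mul]
    rw [add_comm]
    refine congrArg₂ (· + ·) ?_ ?_
    · simp [secularJacobian, secularCoord, Fin.tail, div_eq_mul_inv]
    · rw [Finset.mul_sum, Finset.mul_sum]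
      refine Finset.sum_congr rfl fun j _ => ?_
      simp only [secularJacobian, Matrix.of_apply, Fin.cons_succ, Fin.tail]
      ring
  · simp only [secularCoord, Fin.tail, div_eq_mul_inv, Pi.mul_apply]
    rfl

end Secular

/-! ### The law of the secular coordinates of a Haar row -/

section SecularLaw

variable {m : ℕ}

theorem injective_of_mem_interlacing {x : Fin (m + 1) → ℝ} (hx : StrictMono x) {y : Fin m → ℝ}
    (hy : y ∈ interlacing x) : StrictMono y := by
  rw [mem_interlacing] at hy
  intro j l hjl
  have : x j.succ ≤ x l.castSucc := hx.monotone (Fin.succ_le_castSucc_iff.2 hjl)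
  exact (hy j).2.trans (this.trans_lt (hy l).1)

theorem measurableSet_interlacing (x : Fin (m + 1) → ℝ) : MeasurableSet (interlacing x) :=
  MeasurableSet.univ_pi fun _ => measurableSet_Ioo

theorem continuous_secularCoord (x : Fin (m + 1) → ℝ) : Continuous (secularCoord x) := by
  unfold secularCoord
  fun_prop

theorem continuous_vandermondeDet (n : ℕ) : Continuous (vandermondeDet : (Fin n → ℝ) → ℝ) := by
  simp_rw [funext fun x : Fin n → ℝ => vandermondeDet_eq_prod x]
  fun_prop

theorem prod_expDensity {n : ℕ} (E : Fin n → ℝ) :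
    ∏ i, expDensity (E i) = {E : Fin n → ℝ | ∀ i, 0 < E i}.indicator
      (fun E => ENNReal.ofReal (Real.exp (-∑ i, E i))) E := by
  by_cases hE : ∀ i, 0 < E i
  · rw [Set.indicator_of_mem (by exact hE), ← Finset.sum_neg_distrib, Real.exp_sum,
      ENNReal.ofReal_prod_of_nonneg fun i _ => (Real.exp_pos _).le]
    exact Finset.prod_congr rfl fun i _ => by simp [expDensity, hE i]
  · rw [Set.indicator_of_notMem (by exact hE)]
    obtain ⟨i, hi⟩ := not_forall.1 hE
    exact Finset.prod_eq_zero (Finset.mem_univ i) (by simp [expDensity, not_lt.1 hi])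

theorem image_secular {x : Fin (m + 1) → ℝ} (hx : StrictMono x) :
    (fun q : Fin (m + 1) → ℝ => fun k => q 0 * secularCoord x (Fin.tail q) k) ''
      {q | 0 < q 0 ∧ Fin.tail q ∈ interlacing x} = {E | ∀ k, 0 < E k} := by
  ext E
  constructor
  · rintro ⟨q, ⟨h0, hq⟩, rfl⟩ k
    exact mul_pos h0 (secularCoord_pos hx hq k)
  · intro hE
    obtain ⟨y, hy, h⟩ := exists_interlacing_of_pos hx hE
    refine ⟨Fin.cons (∑ l, E l) y, ⟨?_, by simpa using hy⟩, ?_⟩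
    · exact Finset.sum_pos (fun k _ => hE k) Finset.univ_nonempty
    · ext k
      simpa using (h k).symm

theorem injOn_secular {x : Fin (m + 1) → ℝ} (hx : StrictMono x) :
    Set.InjOn (fun q : Fin (m + 1) → ℝ => fun k => q 0 * secularCoord x (Fin.tail q) k)
      {q | 0 < q 0 ∧ Fin.tail q ∈ interlacing x} := by
  rintro q ⟨h0, hq⟩ q' ⟨-, hq'⟩ h
  have h1 : q 0 = q' 0 := by
    have := congrArg (fun E : Fin (m + 1) → ℝ => ∑ k, E k) h
    simpa only [← Finset.mul_sum, sum_secularCoord hx.injective, mul_one] using this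
  have h2 : Fin.tail q = Fin.tail q' := by
    refine injOn_secularCoord hx hq hq' (funext fun k => ?_)
    have := congrFun h k
    simp only [← h1] at this
    exact mul_left_cancel₀ h0.ne' this
  rw [← Fin.cons_self_tail q, ← Fin.cons_self_tail q', h1, h2]

theorem lintegral_pow_mul_exp_neg (m : ℕ) :
    ∫⁻ r in Set.Ioi (0 : ℝ), ENNReal.ofReal (r ^ m * Real.exp (-r)) = ENNReal.ofReal (m ! : ℕ) := by
  have h1 := Real.Gamma_eq_integral (s := m + 1) (by positivity)
  have h2 := Real.GammaIntegral_convergent (s := m + 1) (by positivity)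
  simp only [add_sub_cancel_right, Real.rpow_natCast] at h1 h2
  rw [Real.Gamma_nat_eq_factorial] at h1
  simp_rw [mul_comm (_ ^ m)]
  rw [h1, ofReal_integral_eq_lintegral_ofReal h2]
  filter_upwards [ae_restrict_mem measurableSet_Ioi] with r hr
  have : (0 : ℝ) < r := hr
  positivity

theorem vandermondeDet_pos {n : ℕ} {x : Fin n → ℝ} (hx : StrictMono x) : 0 < vandermondeDet x := by
  rw [vandermondeDet_eq_prod]
  exact Finset.prod_pos fun i _ => Finset.prod_pos fun j hj => sub_pos.2 (hx (Finset.mem_Ioi.1 hj))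

/-- Change of variables `E = r • secularCoord x y`. As the secular coordinates sum to one, `r` is
the sum of the `E k` and normalizing `E` removes it; the integrand splits into a radial factor and a
factor in `y`. -/
theorem lintegral_expDensity_secular {x : Fin (m + 1) → ℝ} (hx : StrictMono x)
    {f : (Fin (m + 1) → ℝ) → ENNReal} (hf : Measurable f) :
    ∫⁻ E : Fin (m + 1) → ℝ, f (fun k => E k / ∑ l, E l)
        ∂((volume : Measure (Fin (m + 1) → ℝ)).withDensity fun x => ∏ i, expDensity (x i)) =
      ∫⁻ q in {q : Fin (m + 1) → ℝ | 0 < q 0 ∧ Fin.tail q ∈ interlacing x},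
        ENNReal.ofReal (q 0 ^ m * Real.exp (-q 0)) *
          (ENNReal.ofReal (vandermondeDet (Fin.tail q) / vandermondeDet x) *
            f (secularCoord x (Fin.tail q))) := by
  have hmS : MeasurableSet {q : Fin (m + 1) → ℝ | 0 < q 0 ∧ Fin.tail q ∈ interlacing x} := by
    have h1 : Measurable fun q : Fin (m + 1) → ℝ => Fin.tail q :=
      measurable_pi_iff.2 fun j => measurable_pi_apply j.succ
    exact (measurableSet_lt measurable_const (measurable_pi_apply 0)).inter
      (h1 (measurableSet_interlacing x))
  have hmE : MeasurableSet {E : Fin (m + 1) → ℝ | ∀ i, 0 < E i} := by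
    rw [Set.ofPred_forall]
    exact MeasurableSet.iInter fun i => measurableSet_lt measurable_const (measurable_pi_apply i)
  have hmd : Measurable fun E : Fin (m + 1) → ℝ => ∏ i, expDensity (E i) :=
    Finset.measurable_prod _ fun i _ => measurable_expDensity.comp (measurable_pi_apply i)
  have hq : Measurable fun x : Fin (m + 1) → ℝ => fun k => x k / ∑ l, x l := by fun_prop
  have h0 := lintegral_withDensity_eq_lintegral_mul volume hmd (hf.comp hq)
  have h1 (E : Fin (m + 1) → ℝ) : ((fun E : Fin (m + 1) → ℝ => ∏ i, expDensity (E i)) *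
      (f ∘ fun x : Fin (m + 1) → ℝ => fun k => x k / ∑ l, x l)) E =
      {E : Fin (m + 1) → ℝ | ∀ i, 0 < E i}.indicator
        (fun E => ENNReal.ofReal (Real.exp (-∑ i, E i)) * f (fun k => E k / ∑ l, E l)) E := by
    rw [Pi.mul_apply, prod_expDensity]
    by_cases hE : E ∈ {E : Fin (m + 1) → ℝ | ∀ i, 0 < E i}
    · rw [Set.indicator_of_mem hE, Set.indicator_of_mem hE]
      rfl
    · rw [Set.indicator_of_notMem hE, Set.indicator_of_notMem hE, zero_mul]
  simp_rw [h1] at h0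
  refine h0.trans ?_
  rw [lintegral_indicator hmE, ← image_secular hx,
    lintegral_image_eq_lintegral_abs_det_fderiv_mul volume hmS
      (fun q _ => (hasFDerivAt_secular x q).hasFDerivWithinAt) (injOn_secular hx)]
  refine setLIntegral_congr_fun hmS fun q hq => ?_
  have hy : StrictMono (Fin.tail q) := injective_of_mem_interlacing hx hq.2
  have hdet : |(LinearMap.toContinuousLinearMap (Matrix.toLin' (secularJacobian x q))).det| =
      q 0 ^ m * (vandermondeDet (Fin.tail q) / vandermondeDet x) := by
    rw [ContinuousLinearMap.det, LinearMap.coe_toContinuousLinearMap, LinearMap.det_toLin',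
      abs_det_secularJacobian hx.injective hy.injective, abs_of_pos hq.1,
      abs_of_pos (vandermondeDet_pos hx), abs_of_pos (vandermondeDet_pos hy)]
  have hsum : ∑ k, q 0 * secularCoord x (Fin.tail q) k = q 0 := by
    rw [← Finset.mul_sum, sum_secularCoord hx.injective, mul_one]
  have hdiv : (fun k => q 0 * secularCoord x (Fin.tail q) k /
      ∑ l, q 0 * secularCoord x (Fin.tail q) l) = secularCoord x (Fin.tail q) := by
    ext k
    rw [hsum, mul_div_cancel_left₀ _ hq.1.ne']
  have hpos : 0 ≤ vandermondeDet (Fin.tail q) / vandermondeDet x :=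
    div_nonneg (vandermondeDet_pos hy).le (vandermondeDet_pos hx).le
  simp only [hdet]
  rw [hdiv, hsum, ← mul_assoc, ← mul_assoc, ← ENNReal.ofReal_mul (mul_nonneg (pow_nonneg hq.1.le _)
    hpos), ← ENNReal.ofReal_mul (mul_nonneg (pow_nonneg hq.1.le _) (Real.exp_pos _).le)]
  congr 2
  ring

/-- The radial factor integrates to `Γ(m + 1)`, which is the source of `m !`. -/
theorem lintegral_haarU_row_eq {x : Fin (m + 1) → ℝ} (hx : StrictMono x)
    {f : (Fin (m + 1) → ℝ) → ENNReal} (hf : Measurable f) :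
    ∫⁻ U, f (fun k => Complex.normSq (U.1 0 k)) ∂haarU (m + 1) =
      ∫⁻ y in interlacing x, ENNReal.ofReal (m ! * (vandermondeDet y / vandermondeDet x)) *
        f (secularCoord x y) := by
  rw [lintegral_haarU_row hf, lintegral_expDensity_secular hx hf]
  have hpre := (volume_preserving_piFinSuccAbove (fun _ : Fin (m + 1) => ℝ) 0).setLIntegral_comp_preimage_emb
    (MeasurableEquiv.measurableEmbedding _)
    (fun p : ℝ × (Fin m → ℝ) => ENNReal.ofReal (p.1 ^ m * Real.exp (-p.1)) *
      (ENNReal.ofReal (vandermondeDet p.2 / vandermondeDet x) * f (secularCoord x p.2)))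
    (Set.Ioi 0 ×ˢ interlacing x)
  have hg : Measurable fun y : Fin m → ℝ =>
      ENNReal.ofReal (vandermondeDet y / vandermondeDet x) * f (secularCoord x y) :=
    (((continuous_vandermondeDet m).measurable.div_const _).ennreal_ofReal).mul
      (hf.comp (continuous_secularCoord x).measurable)
  have hr : Measurable fun r : ℝ => ENNReal.ofReal (r ^ m * Real.exp (-r)) := by fun_prop
  refine hpre.trans ?_
  rw [Measure.volume_eq_prod, ← Measure.prod_restrict,
    lintegral_prod_mul (f := fun r : ℝ => ENNReal.ofReal (r ^ m * Real.exp (-r)))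
      (g := fun y : Fin m → ℝ => ENNReal.ofReal (vandermondeDet y / vandermondeDet x) *
        f (secularCoord x y)) hr.aemeasurable hg.aemeasurable,
    lintegral_pow_mul_exp_neg, ← lintegral_const_mul _ hg]
  refine lintegral_congr fun y => ?_
  rw [← mul_assoc, ← ENNReal.ofReal_mul (by positivity)]

/-- The law of the squared moduli of the entries of the first row of a Haar unitary matrix. -/
theorem map_normSq_row_haarU {x : Fin (m + 1) → ℝ} (hx : StrictMono x) :
    (haarU (m + 1)).map (fun U => fun k => Complex.normSq (U.1 0 k)) =
      ((volume.restrict (interlacing x)).withDensity fun y =>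
        ENNReal.ofReal (m ! * (vandermondeDet y / vandermondeDet x))).map (secularCoord x) := by
  have hp : Measurable fun U : UG (m + 1) => fun k => Complex.normSq (U.1 0 k) := by
    refine Continuous.measurable (continuous_pi fun k => Complex.continuous_normSq.comp ?_)
    exact (continuous_subtype_val : Continuous fun U : UG (m + 1) => U.1).matrix_elem 0 k
  have hd : Measurable fun y : Fin m → ℝ =>
      ENNReal.ofReal (m ! * (vandermondeDet y / vandermondeDet x)) :=
    (((continuous_vandermondeDet m).measurable.div_const _).const_mul _).ennreal_ofReal
  refine Measure.ext_of_lintegral _ fun f hf => ?_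
  rw [lintegral_map hf hp, lintegral_map hf (continuous_secularCoord x).measurable,
    lintegral_haarU_row_eq hx hf]
  exact (lintegral_withDensity_eq_lintegral_mul _ hd
    (hf.comp (continuous_secularCoord x).measurable)).symm

end SecularLaw

/-! ### Principal minors -/

section Minor

variable {m : ℕ}

/-- The Hermitian matrix obtained by deleting the first row and column. -/
def minor (A : Herm (m + 1)) : Herm m :=
  ⟨(A : Matrix (Fin (m + 1)) (Fin (m + 1)) ℂ).submatrix Fin.succ Fin.succ, by
    rw [selfAdjoint.mem_iff, Matrix.star_eq_conjTranspose, Matrix.conjTranspose_submatrix]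
    congr 1
    exact A.2⟩

theorem coe_minor (A : Herm (m + 1)) : (minor A : Matrix (Fin m) (Fin m) ℂ) =
    (A : Matrix (Fin (m + 1)) (Fin (m + 1)) ℂ).submatrix Fin.succ Fin.succ := rfl

@[fun_prop]
theorem continuous_minor {T : Type*} [TopologicalSpace T] {f : T → Herm (m + 1)}
    (hf : Continuous f) : Continuous fun t => minor (f t) := by
  refine continuous_induced_rng.2 ?_
  simp only [Function.comp_def, coe_minor]
  have h : Continuous fun t => (f t : Matrix (Fin (m + 1)) (Fin (m + 1)) ℂ) :=
    continuous_subtype_val.comp hf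
  exact h.matrix_submatrix _ _

/-- The block diagonal unitary matrix `1 ⊕ W`. -/
def blockOne (W : UG m) : UG (m + 1) :=
  ⟨Matrix.of (Fin.cons (Fin.cons 1 0) fun i => Fin.cons 0 (W.1 i)), by
    rw [Matrix.mem_unitaryGroup_iff]
    have h : W.1 * star W.1 = 1 := Unitary.coe_mul_star_self W
    ext i j
    rw [Matrix.mul_apply, Fin.sum_univ_succ]
    simp only [Matrix.star_apply, Matrix.of_apply]
    refine Fin.cases ?_ (fun i => ?_) i <;> refine Fin.cases ?_ (fun j => ?_) j
    · simp
    · simp [(Fin.succ_ne_zero j).symm]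
    · simp
    · have := congrFun (congrFun h i) j
      simp only [Matrix.mul_apply, Matrix.star_apply] at this
      simp only [Fin.cons_succ, Fin.cons_zero, zero_mul, zero_add, this, Matrix.one_apply,
        Fin.succ_inj]⟩

theorem blockOne_succ (W : UG m) (i : Fin m) (j : Fin (m + 1)) :
    (blockOne W).1 i.succ j = (Fin.cons 0 (W.1 i) : Fin (m + 1) → ℂ) j := rfl

theorem minor_conj_blockOne (W : UG m) (A : Herm (m + 1)) :
    minor (conj (blockOne W) A) = conj W (minor A) := by
  ext1
  ext i j
  rw [coe_minor, coe_conj, coe_conj, coe_minor, Matrix.submatrix_apply, Matrix.mul_apply,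
    Matrix.mul_apply, Fin.sum_univ_succ]
  simp only [Matrix.star_apply, blockOne_succ, Fin.cons_zero, Fin.cons_succ, star_zero, mul_zero,
    zero_add]
  refine Finset.sum_congr rfl fun k _ => ?_
  rw [Matrix.mul_apply, Matrix.mul_apply, Fin.sum_univ_succ]
  simp [blockOne_succ]

theorem pairing_hdiag_cons_zero (t : Fin m → ℝ) (A : Herm (m + 1)) :
    pairing (hdiag (Fin.cons 0 t : Fin (m + 1) → ℝ)) A = pairing (hdiag t) (minor A) := by
  rw [pairing_hdiag_left, pairing_hdiag_left, Fin.sum_univ_succ]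
  simp [coe_minor]

/-- With first parameter zero the pairing sees only the minor. Translating by `1 ⊕ W` conjugates the
minor by `W`, and averaging over `W` produces the smaller spherical function. -/
theorem sphericalKernel_cons_zero (t : Fin m → ℝ) (x : Fin (m + 1) → ℝ) :
    sphericalKernel (Fin.cons 0 t : Fin (m + 1) → ℝ) x =
      ∫ U, sphericalKernel t (eigenvalues (minor (conj U (hdiag x)))) ∂haarU (m + 1) := by
  have h1 (W : UG m) : sphericalKernel (Fin.cons 0 t : Fin (m + 1) → ℝ) x =
      ∫ U, expI (pairing (hdiag t) (conj W (minor (conj U (hdiag x))))) ∂haarU (m + 1) := by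
    rw [sphericalKernel, ← integral_mul_left_eq_self (μ := haarU (m + 1)) _ (blockOne W)]
    refine integral_congr_ae (.of_forall fun U => ?_)
    simp only [conj_mul]
    rw [pairing_hdiag_cons_zero, minor_conj_blockOne]
  have h2 : sphericalKernel (Fin.cons 0 t : Fin (m + 1) → ℝ) x =
      ∫ W, ∫ U, expI (pairing (hdiag t) (conj W (minor (conj U (hdiag x))))) ∂haarU (m + 1)
        ∂haarU m := by
    simp_rw [← h1]
    simp
  rw [h2, integral_integral_swap]
  · refine integral_congr_ae (.of_forall fun U => ?_)
    have := integral_expI_pairing_conj_eq 1 t (minor (conj U (hdiag x)))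
    rwa [conj_one] at this
  · refine (integrable_const (1 : ℝ)).mono' (Continuous.aestronglyMeasurable ?_)
      (.of_forall fun p => (norm_expI _).le)
    unfold Function.uncurry
    fun_prop

-- The characteristic polynomial of the minor is the `(0, 0)` entry of the adjugate of `X - A`.
-- Diagonalization turns that adjugate into `V N V*`, where the diagonal matrix `N` has entries
-- `∏_{l ≠ k} (X - x_l)`.
open Polynomial in
theorem charpoly_minor_conj_hdiag (U : UG (m + 1)) (x : Fin (m + 1) → ℝ) :
    (minor (conj U (hdiag x)) : Matrix (Fin m) (Fin m) ℂ).charpoly =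
      (secularPoly x fun k => Complex.normSq (U.1 0 k)).map Complex.ofRealHom := by
  set A : Matrix (Fin (m + 1)) (Fin (m + 1)) ℂ := ((conj U (hdiag x) : Herm (m + 1)) : Matrix (Fin (m + 1)) (Fin (m + 1)) ℂ) with hA
  let V : Matrix (Fin (m + 1)) (Fin (m + 1)) ℂ[X] := C.mapMatrix U.1
  let V' : Matrix (Fin (m + 1)) (Fin (m + 1)) ℂ[X] := C.mapMatrix (star U.1)
  have hVV' : V * V' = 1 := by
    simp only [V, V', ← map_mul]
    rw [show U.1 * star U.1 = 1 from Unitary.coe_mul_star_self U, map_one]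
  have hV'V : V' * V = 1 := by
    simp only [V, V', ← map_mul]
    rw [show star U.1 * U.1 = 1 from Unitary.coe_star_mul_self U, map_one]
  let D : Matrix (Fin (m + 1)) (Fin (m + 1)) ℂ[X] := Matrix.diagonal fun k => X - C (x k : ℂ)
  let N : Matrix (Fin (m + 1)) (Fin (m + 1)) ℂ[X] :=
    Matrix.diagonal fun k => ∏ l : Fin m, (X - C (x (k.succAbove l) : ℂ))
  have hchar : A.charmatrix = V * D * V' := by
    have hD : D = Matrix.scalar _ X - C.mapMatrix (Matrix.diagonal fun i => (x i : ℂ)) := by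
      ext1 i j
      by_cases hij : i = j
      · subst hij; simp [D]
      · simp [D, hij]
    rw [hD, mul_sub, sub_mul]
    have h1 : V * Matrix.scalar _ X * V' = Matrix.scalar _ X := by
      rw [← (Matrix.scalar_commute X (fun _ => Commute.all _ _) V).eq, mul_assoc, hVV', mul_one]
    rw [h1]
    simp only [V, V', ← map_mul]
    rfl
  have hdet : A.charmatrix.det = ∏ k, (X - C (x k : ℂ)) := charpoly_conj_hdiag U x
  have hDN : D * N = A.charmatrix.det • (1 : Matrix (Fin (m + 1)) (Fin (m + 1)) ℂ[X]) := by
    rw [hdet, Matrix.diagonal_mul_diagonal, Matrix.smul_one_eq_diagonal]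
    congr 1
    ext1 k
    exact (Fin.prod_univ_succAbove (fun l => X - C (x l : ℂ)) k).symm
  have hmul : A.charmatrix * (V * N * V') = A.charmatrix.det • 1 := by
    calc A.charmatrix * (V * N * V') = V * D * (V' * V) * N * V' := by
          rw [hchar]; simp only [mul_assoc]
      _ = V * (D * N) * V' := by rw [hV'V, mul_one, mul_assoc V D N]
      _ = _ := by rw [hDN, mul_smul_comm, mul_one, smul_mul_assoc, hVV']
  have hne : A.charmatrix.det ≠ 0 := by
    rw [hdet]
    exact (monic_prod_X_sub_C _ _).ne_zero
  have hadj : A.charmatrix.adjugate = V * N * V' := by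
    -- Multiplication by the adjugate puts `det` in front of both candidates; it cancels, being a
    -- nonzero polynomial.
    have h1 := congrArg (A.charmatrix.adjugate * ·) hmul
    simp only [← mul_assoc, Matrix.adjugate_mul, smul_mul_assoc, one_mul, mul_smul_comm,
      mul_one] at h1
    have h2 := smul_right_injective _ hne h1
    exact h2.symm
  have h00 : A.charmatrix.adjugate 0 0 =
      (minor (conj U (hdiag x)) : Matrix (Fin m) (Fin m) ℂ).charpoly := by
    rw [Matrix.adjugate_fin_succ_eq_det_submatrix]
    simp only [Fin.val_zero, add_zero, pow_zero, one_mul]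
    rw [Matrix.charpoly]
    congr 1
    ext1 i j
    by_cases hij : i = j
    · subst hij; simp [coe_minor, hA]
    · simp [coe_minor, hA, hij, Matrix.charmatrix_apply_ne]
  rw [← h00, hadj, Matrix.mul_apply, secularPoly, Polynomial.map_sum]
  refine Finset.sum_congr rfl fun k _ => ?_
  rw [Matrix.mul_diagonal, Polynomial.map_mul, Polynomial.map_prod]
  have h3 : V 0 k * V' k 0 = C ((Complex.normSq (U.1 0 k) : ℝ) : ℂ) := by
    rw [← Complex.mul_conj, map_mul]
    rfl
  simp only [Polynomial.map_sub, map_X, map_C, Complex.ofRealHom_eq_coe]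
  rw [← h3]
  ring

theorem sphericalKernel_minor_of_row_eq {x : Fin (m + 1) → ℝ} (hx : StrictMono x) {y : Fin m → ℝ}
    {U : UG (m + 1)} (h : (fun k => Complex.normSq (U.1 0 k)) = secularCoord x y) (t : Fin m → ℝ) :
    sphericalKernel t (eigenvalues (minor (conj U (hdiag x)))) = sphericalKernel t y := by
  refine sphericalKernel_eigenvalues_of_charpoly t ?_
  have h1 := secularPoly_mul_secularCoord hx.injective 1 y
  simp only [one_mul, Polynomial.C_1] at h1
  rw [charpoly_minor_conj_hdiag, h]
  change (secularPoly x fun k => secularCoord x y k).map Complex.ofRealHom = _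
  rw [h1, Polynomial.map_prod]
  simp

theorem sphericalKernel_cons_zero_eq_integral {x : Fin (m + 1) → ℝ} (hx : StrictMono x)
    (t : Fin m → ℝ) :
    sphericalKernel (Fin.cons 0 t : Fin (m + 1) → ℝ) x =
      ∫ y in interlacing x, ((m ! * (vandermondeDet y / vandermondeDet x) : ℝ) : ℂ) *
        sphericalKernel t y := by
  have hI := measurableSet_interlacing x
  have hemb : MeasurableEmbedding ((interlacing x).domRestrict (secularCoord x)) :=
    (continuous_secularCoord x).continuousOn.measurableEmbedding hI (injOn_secularCoord hx)
  -- The kernel as a function of the squared moduli, through the inverse of `secularCoord x` on the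
  -- interlacing set. That map is continuous and injective there, hence a measurable embedding; the
  -- value `0` off its image is harmless, since almost every row lands in the image by `hae`.
  let F : (Fin (m + 1) → ℝ) → ℂ :=
    Function.extend ((interlacing x).domRestrict (secularCoord x))
      (fun y => sphericalKernel t y.1) 0
  have hK : Continuous fun y => sphericalKernel t y := by fun_prop
  have hF : Measurable F :=
    hemb.measurable_extend (hK.measurable.comp measurable_subtype_coe) measurable_zero
  have hFy {y : Fin m → ℝ} (hy : y ∈ interlacing x) :
      F (secularCoord x y) = sphericalKernel t y :=
    hemb.injective.extend_apply _ _ (⟨y, hy⟩ : interlacing x)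
  have hp : Measurable fun U : UG (m + 1) => fun k => Complex.normSq (U.1 0 k) := by
    refine Continuous.measurable (continuous_pi fun k => Complex.continuous_normSq.comp ?_)
    exact (continuous_subtype_val : Continuous fun U : UG (m + 1) => U.1).matrix_elem 0 k
  have hd : Measurable fun y : Fin m → ℝ => (m ! * (vandermondeDet y / vandermondeDet x)).toNNReal :=
    (((continuous_vandermondeDet m).measurable.div_const _).const_mul _).real_toNNReal
  have hmap := map_normSq_row_haarU hx
  have hae : ∀ᵐ U ∂haarU (m + 1),
      (fun k => Complex.normSq (U.1 0 k)) ∈ secularCoord x '' interlacing x := by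
    have hm : MeasurableSet (secularCoord x '' interlacing x) := by
      have := hemb.measurableSet_range
      rwa [Set.range_domRestrict] at this
    have h1 : ∀ᵐ p ∂((volume.restrict (interlacing x)).withDensity fun y =>
        ENNReal.ofReal (m ! * (vandermondeDet y / vandermondeDet x))).map (secularCoord x),
        p ∈ secularCoord x '' interlacing x := by
      refine (ae_map_iff (p := fun p => p ∈ secularCoord x '' interlacing x)
        (continuous_secularCoord x).measurable.aemeasurable hm).2 ?_
      refine (withDensity_absolutelyContinuous _ _).ae_le ?_
      filter_upwards [ae_restrict_mem hI] with y hy using ⟨y, hy, rfl⟩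
    rw [← hmap] at h1
    exact ae_of_ae_map hp.aemeasurable h1
  rw [sphericalKernel_cons_zero]
  have h2 : ∫ U, sphericalKernel t (eigenvalues (minor (conj U (hdiag x)))) ∂haarU (m + 1) =
      ∫ U, F (fun k => Complex.normSq (U.1 0 k)) ∂haarU (m + 1) := by
    refine integral_congr_ae ?_
    filter_upwards [hae] with U hU
    obtain ⟨y, hy, h⟩ := hU
    rw [sphericalKernel_minor_of_row_eq hx h.symm, ← hFy hy, h]
  rw [h2, ← integral_map hp.aemeasurable hF.aestronglyMeasurable, hmap,
    integral_map (continuous_secularCoord x).measurable.aemeasurable hF.aestronglyMeasurable]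
  change ∫ y, F (secularCoord x y) ∂((volume.restrict (interlacing x)).withDensity fun y =>
    (((m ! * (vandermondeDet y / vandermondeDet x)).toNNReal : NNReal) : ENNReal)) = _
  rw [integral_withDensity_eq_integral_smul hd]
  refine setIntegral_congr_fun hI fun y hy => ?_
  have hpos : 0 ≤ m ! * (vandermondeDet y / vandermondeDet x) :=
    mul_nonneg (by positivity) (div_nonneg
      (vandermondeDet_pos (injective_of_mem_interlacing hx hy)).le (vandermondeDet_pos hx).le)
  simp only [hFy hy]
  rw [NNReal.smul_def, Real.coe_toNNReal _ hpos, Complex.real_smul]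

end Minor

/-! ### The Harish-Chandra–Itzykson–Zuber formula -/

/-- The determinant `det [exp (i s_j x_k)]`. -/
def expDet {n : ℕ} (s x : Fin n → ℝ) : ℂ := (Matrix.of fun j k => expI (s j * x k)).det

/-- Keeping `t * I` on the left avoids excluding `t = 0`. -/
theorem mul_integral_expI {a b : ℝ} (hab : a ≤ b) (t : ℝ) :
    (t * Complex.I) * ∫ y in Set.Ioo a b, expI (t * y) = expI (t * b) - expI (t * a) := by
  have h1 (y : ℝ) : HasDerivAt (fun y : ℝ => expI (t * y)) (t * Complex.I * expI (t * y)) y := by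
    have h2 : HasDerivAt (fun y : ℝ => ((t * y : ℝ) : ℂ) * Complex.I) ((t : ℂ) * Complex.I) y := by
      have := (((hasDerivAt_id y).const_mul t).ofReal_comp).mul_const Complex.I
      simpa using this
    have := h2.cexp
    rwa [mul_comm] at this
  have hc : Continuous fun y : ℝ => (t : ℂ) * Complex.I * expI (t * y) := by fun_prop
  rw [← integral_const_mul, ← integral_Ioc_eq_integral_Ioo,
    ← intervalIntegral.integral_of_le hab,
    intervalIntegral.integral_eq_sub_of_hasDerivAt (fun y _ => h1 y) (hc.intervalIntegrable _ _)]

theorem integral_interlacing_expDet {m : ℕ} (x : Fin (m + 1) → ℝ) (t : Fin m → ℝ) :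
    ∫ y in interlacing x, expDet t y =
      (Matrix.of fun j k : Fin m => ∫ u in Set.Ioo (x k.castSucc) (x k.succ), expI (t j * u)).det := by
  have hrestr : (volume : Measure (Fin m → ℝ)).restrict (interlacing x) =
      Measure.pi fun k : Fin m => (volume : Measure ℝ).restrict (Set.Ioo (x k.castSucc) (x k.succ)) :=
    Measure.restrict_pi_pi (fun _ : Fin m => (volume : Measure ℝ)) _
  have hint (σ : Equiv.Perm (Fin m)) : Integrable (fun y : Fin m → ℝ => ∏ k, expI (t (σ k) * y k))
      (Measure.pi fun k : Fin m =>
        (volume : Measure ℝ).restrict (Set.Ioo (x k.castSucc) (x k.succ))) := by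
    refine (integrable_const (1 : ℝ)).mono' (Continuous.aestronglyMeasurable (by fun_prop))
      (.of_forall fun y => ?_)
    simp [norm_expI]
  simp only [expDet, Matrix.det_apply', Matrix.of_apply]
  rw [hrestr, integral_finsetSum _ fun σ _ => (hint σ).const_mul _]
  refine Finset.sum_congr rfl fun σ _ => ?_
  rw [integral_const_mul, integral_fintype_prod_eq_prod (𝕜 := ℂ)
    (μ := fun k : Fin m => (volume : Measure ℝ).restrict (Set.Ioo (x k.castSucc) (x k.succ)))
    (f := fun k u => expI (t (σ k) * u))]

/-- Subtracting from each column its predecessor reduces the first row, which is constantly `1`, to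
`(1, 0, …, 0)`. -/
theorem expDet_cons_zero {m : ℕ} (t : Fin m → ℝ) (x : Fin (m + 1) → ℝ) :
    expDet (Fin.cons 0 t : Fin (m + 1) → ℝ) x =
      (Matrix.of fun j k : Fin m => expI (t j * x k.succ) - expI (t j * x k.castSucc)).det := by
  let B : Matrix (Fin (m + 1)) (Fin (m + 1)) ℂ := Matrix.of fun j =>
    Fin.cons (expI ((Fin.cons 0 t : Fin (m + 1) → ℝ) j * x 0)) fun k =>
      expI ((Fin.cons 0 t : Fin (m + 1) → ℝ) j * x k.succ) -
        expI ((Fin.cons 0 t : Fin (m + 1) → ℝ) j * x k.castSucc)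
  have h1 : expDet (Fin.cons 0 t : Fin (m + 1) → ℝ) x = B.det := by
    refine Matrix.det_eq_of_forall_col_eq_smul_add_pred (fun _ => 1) (fun j => ?_) fun j k => ?_
    · simp [B]
    · simp [B]
  rw [h1, Matrix.det_succ_row_zero, Finset.sum_eq_single 0]
  · simp only [Fin.val_zero, pow_zero, one_mul]
    have h2 : B 0 0 = 1 := by simp [B, expI_zero]
    rw [h2, one_mul]
    congr 1
  · intro k _ hk
    obtain ⟨k, rfl⟩ := Fin.exists_succ_eq.2 hk
    simp [B, expI_zero]
  · simp

/-- The density `m! Δ(y)/Δ(x)` supplies the `Δ(y)` that the induction hypothesis needs, and the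
extra factor `∏ t_j` of `Δ(0, t)` supplies the multipliers with which the exponentials integrate to
differences. -/
theorem sphericalKernel_cons_zero_mul {m : ℕ} {c : ℂ}
    (ih : ∀ s x : Fin m → ℝ,
      (vandermondeDet s * vandermondeDet x : ℂ) * sphericalKernel s x = c * expDet s x)
    {x : Fin (m + 1) → ℝ} (hx : StrictMono x) (t : Fin m → ℝ) :
    (vandermondeDet (Fin.cons 0 t : Fin (m + 1) → ℝ) * vandermondeDet x : ℂ) *
      sphericalKernel (Fin.cons 0 t : Fin (m + 1) → ℝ) x =
        ((m ! : ℕ) * c / Complex.I ^ m) * expDet (Fin.cons 0 t : Fin (m + 1) → ℝ) x := by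
  have hΔ : (vandermondeDet x : ℂ) ≠ 0 := by exact_mod_cast (vandermondeDet_pos hx).ne'
  have h1 : (vandermondeDet t * vandermondeDet x : ℂ) *
      sphericalKernel (Fin.cons 0 t : Fin (m + 1) → ℝ) x =
        ((m ! : ℕ) * c) * ∫ y in interlacing x, expDet t y := by
    rw [sphericalKernel_cons_zero_eq_integral hx, ← integral_const_mul, ← integral_const_mul]
    refine setIntegral_congr_fun (measurableSet_interlacing x) fun y _ => ?_
    have := ih t y
    push_cast
    rw [mul_assoc _ c, ← this]
    field_simp
  have h2 : (Complex.I ^ m * ∏ j, (t j : ℂ)) * ∫ y in interlacing x, expDet t y =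
      expDet (Fin.cons 0 t : Fin (m + 1) → ℝ) x := by
    rw [integral_interlacing_expDet, expDet_cons_zero]
    have h3 : Complex.I ^ m * ∏ j, (t j : ℂ) = ∏ j, ((t j : ℂ) * Complex.I) := by
      rw [Finset.prod_mul_distrib, mul_comm]
      simp
    rw [h3, ← Matrix.det_mul_column]
    congr 1
    ext j k
    simp only [Matrix.of_apply]
    exact mul_integral_expI (hx.monotone (Fin.castSucc_le_succ k)) (t j)
  rw [vandermondeDet_cons, ← h2]
  have hI : Complex.I ^ m ≠ 0 := pow_ne_zero _ Complex.I_ne_zero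
  have h4 : ((∏ l, (t l - 0)) * vandermondeDet t : ℝ) = (∏ l, t l) * vandermondeDet t := by simp
  rw [h4]
  push_cast
  rw [mul_assoc (∏ l, (t l : ℂ)), mul_assoc (∏ l, (t l : ℂ)), h1]
  field_simp

theorem vandermondeDet_comp_perm {n : ℕ} (x : Fin n → ℝ) (σ : Equiv.Perm (Fin n)) :
    vandermondeDet (x ∘ σ) = (Equiv.Perm.sign σ : ℤ) * vandermondeDet x := by
  rw [vandermondeDet, vandermondeDet, ← Matrix.det_permute]
  rfl

theorem expDet_comp_perm {n : ℕ} (s x : Fin n → ℝ) (σ : Equiv.Perm (Fin n)) :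
    expDet s (x ∘ σ) = (Equiv.Perm.sign σ : ℤ) * expDet s x := by
  rw [expDet, expDet, ← Matrix.det_permute']
  rfl

/-- The Harish-Chandra–Itzykson–Zuber formula. -/
theorem exists_sphericalKernel_eq (n : ℕ) : ∃ c : ℂ, c ≠ 0 ∧ ∀ s x : Fin n → ℝ,
    (vandermondeDet s * vandermondeDet x : ℂ) * sphericalKernel s x = c * expDet s x := by
  induction n with
  | zero =>
    refine ⟨1, one_ne_zero, fun s x => ?_⟩
    simp [vandermondeDet, expDet, sphericalKernel, pairing_hdiag_left, expI_zero]
  | succ m ih =>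
    obtain ⟨c, hc, ih⟩ := ih
    refine ⟨(m ! : ℕ) * c / Complex.I ^ m, div_ne_zero (mul_ne_zero (by
      exact_mod_cast Nat.factorial_ne_zero m) hc) (pow_ne_zero _ Complex.I_ne_zero), fun s x => ?_⟩
    set c' := (m ! : ℕ) * c / Complex.I ^ m
    -- Increasing `x` suffices: the kernel is symmetric in `x` while `Δ(x)` and `expDet` are
    -- alternating, and both sides vanish when entries repeat.
    have key {x : Fin (m + 1) → ℝ} (hx : StrictMono x) :
        (vandermondeDet s * vandermondeDet x : ℂ) * sphericalKernel s x = c' * expDet s x := by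
      let t : Fin m → ℝ := fun j => s j.succ - s 0
      have hs : (fun j => s j - s 0) = (Fin.cons 0 t : Fin (m + 1) → ℝ) := by
        ext j
        refine Fin.cases ?_ (fun j => ?_) j <;> simp [t]
      have h1 := sphericalKernel_cons_zero_mul ih hx t
      have h2 : vandermondeDet (Fin.cons 0 t : Fin (m + 1) → ℝ) = vandermondeDet s := by
        rw [← hs]
        exact Matrix.det_vandermonde_sub s (s 0)
      have h3 : expDet s x =
          expI (s 0 * ∑ k, x k) * expDet (Fin.cons 0 t : Fin (m + 1) → ℝ) x := by
        rw [← hs, Finset.mul_sum, expI_sum, expDet, expDet, ← Matrix.det_mul_row]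
        congr 1
        ext j k
        simp only [Matrix.of_apply]
        rw [← expI_add]
        congr 1
        ring
      rw [sphericalKernel_shift (s 0) s x, hs, h3, ← h2]
      linear_combination expI (s 0 * ∑ k, x k) * h1
    by_cases hx : Function.Injective x
    · have hm : StrictMono (x ∘ Tuple.sort x) :=
        (Tuple.monotone_sort x).strictMono_of_injective (hx.comp (Equiv.injective _))
      have h1 := key hm
      rw [vandermondeDet_comp_perm, sphericalKernel_comp_perm, expDet_comp_perm] at h1
      set ε : ℤ := (Equiv.Perm.sign (Tuple.sort x) : ℤ) with hε
      have hε2 : (ε : ℂ) * ε = 1 := by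
        rw [← Int.cast_mul, hε, Int.units_coe_mul_self, Int.cast_one]
      push_cast at h1
      linear_combination (ε : ℂ) * h1 - (vandermondeDet s * vandermondeDet x * sphericalKernel s x -
        c' * expDet s x) * hε2
    · have h1 : vandermondeDet x = 0 := by
        by_contra h
        exact hx (Matrix.det_vandermonde_ne_zero_iff.1 h)
      have h2 : expDet s x = 0 := by
        obtain ⟨i, j, hij, hne⟩ := Function.not_injective_iff.1 hx
        exact Matrix.det_zero_of_column_eq hne fun l => by simp [hij]
      simp [h1, h2]

/-! ### Laws of eigenvalues -/

theorem measurable_eigenvalues_comp {n : ℕ} (σ : Equiv.Perm (Fin n)) :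
    Measurable fun A : Herm n => fun i => eigenvalues A (σ i) := by
  have := measurable_eigenvalues n
  fun_prop

theorem lintegral_eigenvalueLaw {n : ℕ} (μ : Measure (Herm n)) {f : (Fin n → ℝ) → ENNReal}
    (hf : Measurable f) :
    ∫⁻ x, f x ∂eigenvalueLaw μ =
      ((n ! : ℕ) : ENNReal)⁻¹ * ∫⁻ A, ∑ σ : Equiv.Perm (Fin n), f (eigenvalues A ∘ σ) ∂μ := by
  have h (σ : Equiv.Perm (Fin n)) : Measurable fun A : Herm n => f (eigenvalues A ∘ σ) :=
    hf.comp (measurable_eigenvalues_comp σ)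
  rw [eigenvalueLaw, lintegral_smul_measure, lintegral_finsetSum_measure,
    lintegral_finsetSum _ fun σ _ => h σ, smul_eq_mul]
  congr 1
  exact Finset.sum_congr rfl fun σ _ => lintegral_map hf (measurable_eigenvalues_comp σ)

theorem eigenvalueLaw_add {n : ℕ} (μ ν : Measure (Herm n)) :
    eigenvalueLaw (μ + ν) = eigenvalueLaw μ + eigenvalueLaw ν := by
  simp only [eigenvalueLaw, Measure.map_add _ _ (measurable_eigenvalues_comp _),
    Finset.sum_add_distrib, smul_add]

instance instIsProbabilityMeasureEigenvalueLaw {n : ℕ} (μ : Measure (Herm n))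
    [IsProbabilityMeasure μ] : IsProbabilityMeasure (eigenvalueLaw μ) := by
  constructor
  rw [← lintegral_one, lintegral_eigenvalueLaw μ measurable_const]
  simp only [Finset.sum_const, Finset.card_univ, Fintype.card_perm, Fintype.card_fin,
    lintegral_const, measure_univ, mul_one, nsmul_eq_mul]
  exact ENNReal.inv_mul_cancel (by exact_mod_cast (Nat.factorial_pos n).ne')
    (ENNReal.natCast_ne_top _)

/-- The law of `U diag(x) U*` for independent `x` of law `ν` and Haar distributed `U`. -/
def unitaryLift {n : ℕ} (ν : Measure (Fin n → ℝ)) : Measure (Herm n) :=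
  (ν.prod (haarU n)).map fun p => conj p.2 (hdiag p.1)

theorem continuous_conj_hdiag (n : ℕ) :
    Continuous fun p : (Fin n → ℝ) × UG n => conj p.2 (hdiag p.1) := by
  fun_prop

instance instIsFiniteMeasureUnitaryLift {n : ℕ} (ν : Measure (Fin n → ℝ)) [IsFiniteMeasure ν] :
    IsFiniteMeasure (unitaryLift ν) :=
  Measure.isFiniteMeasure_map _ _

theorem charTransform_unitaryLift {n : ℕ} (ν : Measure (Fin n → ℝ)) [IsFiniteMeasure ν]
    (V : UG n) (s : Fin n → ℝ) :
    charTransform (unitaryLift ν) (conj V (hdiag s)) = ∫ x, sphericalKernel s x ∂ν := by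
  have hc : Continuous fun A : Herm n => expI (pairing (conj V (hdiag s)) A) := by fun_prop
  rw [charTransform, unitaryLift, integral_map (continuous_conj_hdiag n).measurable.aemeasurable
    hc.aestronglyMeasurable, integral_prod]
  · refine integral_congr_ae (.of_forall fun x => ?_)
    have := integral_expI_pairing_conj V 1 s x
    simpa only [conj_one] using this
  · refine (integrable_const (1 : ℝ)).mono' (Continuous.aestronglyMeasurable ?_)
      (.of_forall fun p => (norm_expI _).le)
    fun_prop

theorem eigenvalueLaw_unitaryLift {n : ℕ} {ν : Measure (Fin n → ℝ)} [IsFiniteMeasure ν]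
    (hν : ∀ σ : Equiv.Perm (Fin n), ν.map (fun x => x ∘ σ) = ν) :
    eigenvalueLaw (unitaryLift ν) = ν := by
  refine Measure.ext_of_lintegral _ fun f hf => ?_
  have hcomp (σ : Equiv.Perm (Fin n)) : Measurable fun x : Fin n → ℝ => x ∘ σ := by
    fun_prop
  have h0 (σ : Equiv.Perm (Fin n)) : Measurable fun A : Herm n => f (eigenvalues A ∘ σ) :=
    hf.comp (measurable_eigenvalues_comp σ)
  rw [lintegral_eigenvalueLaw _ hf, unitaryLift, lintegral_map
    (Finset.measurable_sum _ fun σ _ => h0 σ)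
    (continuous_conj_hdiag n).measurable]
  have h1 (p : (Fin n → ℝ) × UG n) :
      ∑ σ : Equiv.Perm (Fin n), f (eigenvalues (conj p.2 (hdiag p.1)) ∘ σ) =
        ∑ σ : Equiv.Perm (Fin n), f (p.1 ∘ σ) := by
    obtain ⟨τ, hτ⟩ := exists_perm_eigenvalues_conj_hdiag p.2 p.1
    rw [hτ]
    exact Fintype.sum_equiv (Equiv.mulLeft τ) _ _ fun σ => rfl
  simp_rw [h1]
  have h5 (σ : Equiv.Perm (Fin n)) : Measurable fun x : Fin n → ℝ => f (x ∘ σ) :=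
    hf.comp (hcomp σ)
  have h2 : Measurable fun x : Fin n → ℝ => ∑ σ : Equiv.Perm (Fin n), f (x ∘ σ) :=
    Finset.measurable_sum _ fun σ _ => h5 σ
  have h4 : AEMeasurable (fun p : (Fin n → ℝ) × UG n => ∑ σ : Equiv.Perm (Fin n), f (p.1 ∘ σ))
      (ν.prod (haarU n)) := (h2.comp measurable_fst).aemeasurable
  rw [lintegral_prod _ h4]
  simp only [lintegral_const, measure_univ, mul_one]
  rw [lintegral_finsetSum _ fun σ _ => h5 σ]
  have h3 (σ : Equiv.Perm (Fin n)) : ∫⁻ x, f (x ∘ σ) ∂ν = ∫⁻ x, f x ∂ν := by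
    conv_rhs => rw [← hν σ]
    exact (lintegral_map hf (hcomp σ)).symm
  simp only [h3, Finset.sum_const, Finset.card_univ, Fintype.card_perm, Fintype.card_fin,
    nsmul_eq_mul]
  rw [← mul_assoc, ENNReal.inv_mul_cancel (by exact_mod_cast (Nat.factorial_pos n).ne')
    (ENNReal.natCast_ne_top _), one_mul]

theorem map_comp_perm_withDensity {n : ℕ} {g : (Fin n → ℝ) → ENNReal}
    (hg : ∀ (σ : Equiv.Perm (Fin n)) x, g (x ∘ σ) = g x) (σ : Equiv.Perm (Fin n)) :
    ((volume : Measure (Fin n → ℝ)).withDensity g).map (fun x => x ∘ σ) =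
      volume.withDensity g := by
  have hp := volume_measurePreserving_piCongrLeft (fun _ : Fin n => ℝ) σ⁻¹
  have he : ⇑(MeasurableEquiv.piCongrLeft (fun _ : Fin n => ℝ) σ⁻¹) = fun x => x ∘ σ := by
    ext x i
    have := Equiv.piCongrLeft_apply_apply (fun _ : Fin n => ℝ) σ⁻¹ x (σ i)
    change Equiv.piCongrLeft (fun _ : Fin n => ℝ) σ⁻¹ x i = x (σ i)
    simpa using this
  have hemb := (MeasurableEquiv.piCongrLeft (fun _ : Fin n => ℝ) σ⁻¹).measurableEmbedding
  rw [he] at hp hemb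
  ext B hB
  rw [Measure.map_apply hemb.measurable hB, withDensity_apply _ (hemb.measurable hB),
    withDensity_apply _ hB, ← hp.setLIntegral_comp_preimage_emb hemb g B]
  simp_rw [hg]

/-! ### Recovering the density of the eigenvalues from the spherical transform -/

theorem eventually_injective_add_smul {n : ℕ} (s : Fin n → ℝ) :
    ∀ᶠ ε : ℝ in nhdsWithin 0 {0}ᶜ, Function.Injective fun i : Fin n => s i + ε * (i : ℝ) := by
  have h : ∀ i j : Fin n, ∀ᶠ ε : ℝ in nhdsWithin 0 {0}ᶜ,
      s i + ε * (i : ℝ) = s j + ε * (j : ℝ) → i = j := by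
    intro i j
    by_cases hij : s i = s j
    · filter_upwards [self_mem_nhdsWithin] with ε hε h
      rw [hij, add_right_inj] at h
      exact Fin.ext (by exact_mod_cast mul_left_cancel₀ hε h)
    · have hc : Continuous fun ε : ℝ => s i + ε * (i : ℝ) - (s j + ε * (j : ℝ)) := by fun_prop
      have h0 : s i + 0 * (i : ℝ) - (s j + 0 * (j : ℝ)) ≠ 0 := by
        simpa [sub_eq_zero] using hij
      filter_upwards [nhdsWithin_le_nhds (hc.continuousAt.eventually_ne h0)] with ε hε h
      exact absurd (sub_eq_zero.2 h) hε
  filter_upwards [Filter.eventually_all.2 fun i => Filter.eventually_all.2 (h i)] with ε hε i j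
    using hε i j

/-- The perturbations `s i + ε i` are injective for all small `ε ≠ 0`. This extends to all `s` the
identities obtained by dividing by `Δ(s)`. -/
theorem eq_of_eq_on_injective {n : ℕ} {f g : (Fin n → ℝ) → ℂ} (hf : Continuous f)
    (hg : Continuous g) (h : ∀ s, Function.Injective s → f s = g s) (s : Fin n → ℝ) :
    f s = g s := by
  have hc : Continuous fun ε : ℝ => fun i : Fin n => s i + ε * (i : ℝ) := by fun_prop
  have h0 : (fun i : Fin n => s i + 0 * (i : ℝ)) = s := by simp
  have h1 : Filter.Tendsto (fun ε : ℝ => f fun i : Fin n => s i + ε * (i : ℝ))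
      (nhdsWithin 0 {0}ᶜ) (nhds (f s)) := by
    have := (hf.comp hc).tendsto 0
    simp only [Function.comp_def, h0] at this
    exact this.mono_left nhdsWithin_le_nhds
  have h2 : Filter.Tendsto (fun ε : ℝ => g fun i : Fin n => s i + ε * (i : ℝ))
      (nhdsWithin 0 {0}ᶜ) (nhds (g s)) := by
    have := (hg.comp hc).tendsto 0
    simp only [Function.comp_def, h0] at this
    exact this.mono_left nhdsWithin_le_nhds
  refine tendsto_nhds_unique (h1.congr' ?_) h2
  filter_upwards [eventually_injective_add_smul s] with ε hε using h _ hε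

theorem integral_mul_eq_sub_withDensity {T : Type*} [MeasurableSpace T] {μ : Measure T} {ρ : T → ℝ}
    (hρ : Integrable ρ μ) {f : T → ℂ} (hf : AEStronglyMeasurable f μ) {C : ℝ}
    (hC : ∀ x, ‖f x‖ ≤ C) :
    ∫ x, f x * (ρ x : ℂ) ∂μ = ∫ x, f x ∂μ.withDensity (fun x => ENNReal.ofReal (ρ x)) -
      ∫ x, f x ∂μ.withDensity (fun x => ENNReal.ofReal (-ρ x)) := by
  have key {r : T → ℝ} (hr : Integrable r μ) :
      ∫ x, f x ∂μ.withDensity (fun x => ENNReal.ofReal (r x)) = ∫ x, f x * (max (r x) 0 : ℝ) ∂μ := by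
    rw [integral_withDensity_eq_integral_toReal_smul₀ hr.aemeasurable.ennreal_ofReal
      (.of_forall fun x => ENNReal.ofReal_lt_top)]
    refine integral_congr_ae (.of_forall fun x => ?_)
    simp only [ENNReal.toReal_ofReal', Complex.real_smul]
    rw [mul_comm]
  have hint {r : T → ℝ} (hr : Integrable r μ) :
      Integrable (fun x => f x * (max (r x) 0 : ℝ)) μ :=
    (hr.pos_part.ofReal (𝕜 := ℂ)).bdd_mul hf (.of_forall hC)
  rw [key hρ, key (r := fun x => -ρ x) hρ.neg, ← integral_sub (hint hρ) (hint (r := fun x => -ρ x) hρ.neg)]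
  refine integral_congr_ae (.of_forall fun x => ?_)
  simp only
  rw [← mul_sub, ← Complex.ofReal_sub]
  congr 2
  exact (max_zero_sub_max_neg_zero_eq_self (ρ x)).symm

/-- The sign of `ρ` is not known beforehand. Lifting its positive and negative parts `ν₁`, `ν₂` to
matrix laws, Fourier uniqueness gives `μ + unitaryLift ν₂ = unitaryLift ν₁`, hence `eigenvalueLaw μ
+ ν₂ = ν₁`. Therefore the negative part is dominated by the positive part, and as at most one of
them is nonzero at each point, it vanishes. -/
theorem eigenvalueLaw_eq_withDensity {n : ℕ} {μ : Measure (Herm n)} [IsFiniteMeasure μ]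
    {ρ : (Fin n → ℝ) → ℝ} (hρ : Integrable ρ)
    (hsymm : ∀ (σ : Equiv.Perm (Fin n)) x, ρ (x ∘ σ) = ρ x)
    (h : ∀ (V : UG n) (s : Fin n → ℝ), Function.Injective s →
      charTransform μ (conj V (hdiag s)) = ∫ x, sphericalKernel s x * (ρ x : ℂ)) :
    (∀ᵐ x, 0 ≤ ρ x) ∧ eigenvalueLaw μ = volume.withDensity fun x => ENNReal.ofReal (ρ x) := by
  set ν₁ : Measure (Fin n → ℝ) := volume.withDensity fun x => ENNReal.ofReal (ρ x) with hν₁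
  set ν₂ : Measure (Fin n → ℝ) := volume.withDensity fun x => ENNReal.ofReal (-ρ x) with hν₂
  have : IsFiniteMeasure ν₁ := isFiniteMeasure_withDensity_ofReal hρ.2
  have : IsFiniteMeasure ν₂ := isFiniteMeasure_withDensity_ofReal hρ.neg.2
  have hadd (S : Herm n) : charTransform (μ + unitaryLift ν₂) S =
      charTransform μ S + charTransform (unitaryLift ν₂) S :=
    integral_add_measure (integrable_expI_pairing μ S) (integrable_expI_pairing _ S)
  have heq : μ + unitaryLift ν₂ = unitaryLift ν₁ := by
    refine ext_of_charTransform fun S => ?_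
    obtain ⟨V, hV⟩ := exists_conj_hdiag_eigenvalues S
    rw [hV]
    have hc : Continuous fun s : Fin n → ℝ => conj V (hdiag s) := by fun_prop
    refine eq_of_eq_on_injective (f := fun s => charTransform (μ + unitaryLift ν₂) (conj V (hdiag s)))
      (g := fun s => charTransform (unitaryLift ν₁) (conj V (hdiag s)))
      ((continuous_charTransform _).comp hc) ((continuous_charTransform _).comp hc)
      (fun s hs => ?_) _
    have hK : Continuous fun x => sphericalKernel s x := by fun_prop
    simp only [hadd]
    rw [h V s hs, charTransform_unitaryLift, charTransform_unitaryLift,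
      integral_mul_eq_sub_withDensity hρ hK.aestronglyMeasurable (norm_sphericalKernel_le s)]
    ring
  have hlaw : eigenvalueLaw μ + ν₂ = ν₁ := by
    rw [← eigenvalueLaw_unitaryLift (ν := ν₁) (map_comp_perm_withDensity fun σ x => by rw [hsymm]),
      ← heq, eigenvalueLaw_add,
      eigenvalueLaw_unitaryLift (ν := ν₂) (map_comp_perm_withDensity fun σ x => by rw [hsymm])]
  have hle : (fun x => ENNReal.ofReal (-ρ x)) ≤ᵐ[volume] fun x => ENNReal.ofReal (ρ x) := by
    refine ae_le_of_forall_setLIntegral_le_of_sigmaFinite₀ hρ.neg.aemeasurable.ennreal_ofReal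
      fun B hB _ => ?_
    rw [← withDensity_apply _ hB, ← withDensity_apply _ hB, ← hν₁, ← hν₂, ← hlaw]
    exact Measure.le_add_left le_rfl B
  have hpos : ∀ᵐ x, 0 ≤ ρ x := by
    filter_upwards [hle] with x hx
    by_contra! hneg
    rw [ENNReal.ofReal_of_nonpos hneg.le, nonpos_iff_eq_zero, ENNReal.ofReal_eq_zero] at hx
    linarith
  refine ⟨hpos, ?_⟩
  have hzero : ν₂ = 0 := by
    rw [hν₂, withDensity_congr_ae (g := 0), withDensity_zero]
    filter_upwards [hpos] with x hx
    exact ENNReal.ofReal_of_nonpos (neg_nonpos.2 hx)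
  rwa [hzero, add_zero] at hlaw

/-! ### Weighted integrability -/

theorem abs_le_weight_mul (m : ℕ) (y a : ℝ) : |a| ≤ (1 + |y|) ^ m * |a| := by
  have h : (1 : ℝ) ≤ (1 + |y|) ^ m := one_le_pow₀ (by linarith [abs_nonneg y])
  nlinarith [abs_nonneg a]

theorem integrable_of_weight {m : ℕ} {f : ℝ → ℝ} (hf : AEMeasurable f)
    (h : Integrable fun y => (1 + |y|) ^ m * f y) : Integrable f := by
  refine h.mono hf.aestronglyMeasurable (.of_forall fun y => ?_)
  rw [norm_mul, Real.norm_of_nonneg (show (0 : ℝ) ≤ (1 + |y|) ^ m by positivity)]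
  exact abs_le_weight_mul m y (f y)

theorem weight_le (m : ℕ) (x t : ℝ) :
    (1 + |x|) ^ m ≤ (1 + |t|) ^ m * (1 + |x - t|) ^ m := by
  rw [← mul_pow]
  refine pow_le_pow_left₀ (by positivity) ?_ m
  have h1 : |x| ≤ |t| + |x - t| := by
    calc |x| = |t + (x - t)| := by ring_nf
      _ ≤ _ := abs_add_le _ _
  nlinarith [abs_nonneg t, abs_nonneg (x - t)]

/-- The weight is submultiplicative (`weight_le`), so the weighted convolution is dominated by the
convolution of the weighted absolute values. -/
theorem integrable_weight_convolution {m : ℕ} {f g : ℝ → ℝ} (hf : AEMeasurable f)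
    (hg : AEMeasurable g) (hfw : Integrable fun y => (1 + |y|) ^ m * f y)
    (hgw : Integrable fun y => (1 + |y|) ^ m * g y) :
    Integrable fun x => (1 + |x|) ^ m * (f ⋆[ContinuousLinearMap.mul ℝ ℝ, volume] g) x := by
  have hconv := (integrable_of_weight hf hfw).integrable_convolution
    (ContinuousLinearMap.mul ℝ ℝ) (integrable_of_weight hg hgw)
  have hc : Continuous fun x : ℝ => (1 + |x|) ^ m := by fun_prop
  refine (hfw.norm.integrable_convolution (ContinuousLinearMap.mul ℝ ℝ) hgw.norm).mono'
    (hc.aestronglyMeasurable.mul hconv.aestronglyMeasurable) ?_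
  filter_upwards [hfw.norm.ae_convolution_exists (ContinuousLinearMap.mul ℝ ℝ) hgw.norm] with x hx
  rw [norm_mul, Real.norm_eq_abs, abs_of_nonneg (by positivity), convolution, convolution]
  calc (1 + |x|) ^ m * ‖∫ t, ContinuousLinearMap.mul ℝ ℝ (f t) (g (x - t))‖ ≤
      (1 + |x|) ^ m * ∫ t, ‖ContinuousLinearMap.mul ℝ ℝ (f t) (g (x - t))‖ := by
        gcongr
        exact norm_integral_le_integral_norm _
    _ = ∫ t, (1 + |x|) ^ m * ‖ContinuousLinearMap.mul ℝ ℝ (f t) (g (x - t))‖ :=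
        (integral_const_mul _ _).symm
    _ ≤ _ := by
        refine integral_mono_of_nonneg (.of_forall fun t => by positivity) hx
          (.of_forall fun t => ?_)
        simp only [ContinuousLinearMap.mul_apply', norm_mul, Real.norm_eq_abs, abs_pow]
        rw [abs_of_nonneg (show (0 : ℝ) ≤ 1 + |t| by positivity),
          abs_of_nonneg (show (0 : ℝ) ≤ 1 + |x - t| by positivity)]
        calc (1 + |x|) ^ m * (|f t| * |g (x - t)|) ≤
            (1 + |t|) ^ m * (1 + |x - t|) ^ m * (|f t| * |g (x - t)|) := by
              gcongr
              exact weight_le m x t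
          _ = _ := by ring

/-! ### Fourier transforms -/

/-- The Fourier transform `∫ exp (i s y) f(y) dy`. -/
def fourierTransform (f : ℝ → ℝ) (s : ℝ) : ℂ := ∫ y, expI (s * y) * (f y : ℂ)

theorem integrable_expI_mul {f : ℝ → ℝ} (hf : Integrable f) (s : ℝ) :
    Integrable fun y => expI (s * y) * (f y : ℂ) := by
  have hc : Continuous fun y : ℝ => expI (s * y) := by fun_prop
  exact (hf.ofReal (𝕜 := ℂ)).bdd_mul hc.aestronglyMeasurable
    (.of_forall fun y => (norm_expI _).le)

theorem continuous_fourierTransform {f : ℝ → ℝ} (hf : Integrable f) :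
    Continuous (fourierTransform f) := by
  refine continuous_of_dominated (bound := fun y => ‖f y‖)
    (fun s => (integrable_expI_mul hf s).aestronglyMeasurable)
    (fun s => .of_forall fun y => ?_) hf.norm (.of_forall fun y => by fun_prop)
  rw [norm_mul, norm_expI, one_mul, Complex.norm_real]

theorem fourierTransform_zero (f : ℝ → ℝ) : fourierTransform f 0 = ((∫ y, f y : ℝ) : ℂ) := by
  simp only [fourierTransform, zero_mul, expI_zero, one_mul]
  exact integral_ofReal

/-- Multiplication by a character commutes with convolution, so this is the formula for the integral
of a convolution applied to the twisted functions. -/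
theorem fourierTransform_convolution {f g : ℝ → ℝ} (hf : Integrable f) (hg : Integrable g)
    (s : ℝ) : fourierTransform (f ⋆[ContinuousLinearMap.mul ℝ ℝ, volume] g) s =
      fourierTransform f s * fourierTransform g s := by
  have h := integral_convolution (ContinuousLinearMap.mul ℝ ℂ) (integrable_expI_mul hf s)
    (integrable_expI_mul hg s)
  rw [ContinuousLinearMap.mul_apply'] at h
  rw [fourierTransform, fourierTransform, fourierTransform, ← h]
  refine integral_congr_ae (.of_forall fun x => ?_)
  simp only [convolution, ContinuousLinearMap.mul_apply']
  rw [← integral_complex_ofReal, ← integral_const_mul]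
  refine integral_congr_ae (.of_forall fun t => ?_)
  have : expI (s * x) = expI (s * t) * expI (s * (x - t)) := by
    rw [← expI_add]
    ring_nf
  simp only [this]
  push_cast
  ring

theorem fourierTransform_iteratedDeriv {n : ℕ} {w : ℝ → ℝ} (hw : HasDerivatives n w)
    (hi : ∀ k < n, Integrable (iteratedDeriv k w)) (s : ℝ) {k : ℕ} (hk : k < n) :
    fourierTransform (iteratedDeriv k w) s = (-(s * Complex.I)) ^ k * fourierTransform w s := by
  induction k with
  | zero => simp
  | succ k ih =>
    have h1 := hi (k + 1) hk
    rw [iteratedDeriv_succ] at h1 ⊢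
    rw [fourierTransform, integral_expI_mul_deriv (hw.2 k hk) (hi k (by omega)) h1 s]
    change -(s * Complex.I) * fourierTransform (iteratedDeriv k w) s = _
    rw [ih (by omega)]
    ring

/-! ### Spherical transforms of polynomial ensembles -/

/-- The constant in the Harish-Chandra–Itzykson–Zuber formula. -/
def hcizConst (n : ℕ) : ℂ := (exists_sphericalKernel_eq n).choose

theorem vandermondeDet_mul_sphericalKernel {n : ℕ} (s x : Fin n → ℝ) :
    (vandermondeDet s * vandermondeDet x : ℂ) * sphericalKernel s x = hcizConst n * expDet s x :=
  (exists_sphericalKernel_eq n).choose_spec.2 s x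

theorem ofReal_det {n : ℕ} (A : Fin n → Fin n → ℝ) :
    (((Matrix.of A).det : ℝ) : ℂ) = (Matrix.of fun j k => (A j k : ℂ)).det :=
  RingHom.map_det Complex.ofRealHom (Matrix.of A)

theorem ensembleDensity_comp_perm {n : ℕ} (v : Fin n → ℝ → ℝ) (Z : ℝ) (σ : Equiv.Perm (Fin n))
    (x : Fin n → ℝ) : ensembleDensity v Z (x ∘ σ) = ensembleDensity v Z x := by
  have h : (Matrix.of fun j k : Fin n => v k ((x ∘ σ) j)).det =
      (Equiv.Perm.sign σ : ℤ) * (Matrix.of fun j k : Fin n => v k (x j)).det := by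
    rw [← Matrix.det_permute]
    rfl
  have h2 : (((Equiv.Perm.sign σ : ℤ) : ℝ)) * ((Equiv.Perm.sign σ : ℤ) : ℝ) = 1 := by
    rw [← Int.cast_mul, Int.units_coe_mul_self, Int.cast_one]
  rw [ensembleDensity, ensembleDensity, h, vandermondeDet_comp_perm]
  linear_combination (Z⁻¹ * (vandermondeDet x * (Matrix.of fun j k : Fin n => v k (x j)).det)) * h2

theorem aemeasurable_ensembleDensity {n : ℕ} {v : Fin n → ℝ → ℝ} (hv : ∀ k, AEMeasurable (v k))
    (Z : ℝ) : AEMeasurable (ensembleDensity v Z) := by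
  have h (j k : Fin n) : AEMeasurable fun x : Fin n → ℝ => v k (x j) :=
    (hv k).comp_quasiMeasurePreserving (Measure.quasiMeasurePreserving_eval (fun _ => volume) j)
  refine ((continuous_vandermondeDet n).aemeasurable.mul ?_).const_mul _
  simp only [Matrix.det_apply, Matrix.of_apply]
  refine Finset.aemeasurable_fun_sum _ fun σ _ => AEMeasurable.const_smul ?_ _
  exact Finset.aemeasurable_fun_prod _ fun i _ => h _ _

/-- The Vandermonde factor is a determinant of monomials of degree at most `n - 1`, each dominated
by the weight, so `integrable_det_mul_det` applies. -/
theorem integrable_ensembleDensity {n : ℕ} {v : Fin n → ℝ → ℝ} (hv : ∀ k, AEMeasurable (v k))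
    (hw : ∀ k, Integrable fun y => (1 + |y|) ^ (n - 1) * v k y) (Z : ℝ) :
    Integrable (ensembleDensity v Z) := by
  have h : Integrable fun x : Fin n → ℝ =>
      (Matrix.of fun j k : Fin n => ((x k : ℂ)) ^ (j : ℕ)).det *
        (Matrix.of fun j k : Fin n => (v k (x j) : ℂ)).det := by
    refine integrable_det_mul_det (f := fun j y => (y : ℂ) ^ (j : ℕ))
      (g := fun k y => (v k y : ℂ)) fun j k => ?_
    refine (hw k).norm.mono' ?_ (.of_forall fun y => ?_)
    · have hc : Continuous fun y : ℝ => (y : ℂ) ^ (j : ℕ) := by fun_prop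
      exact hc.aestronglyMeasurable.mul
        (Complex.measurable_ofReal.comp_aemeasurable (hv k)).aestronglyMeasurable
    · rw [norm_mul, norm_mul, norm_pow, Complex.norm_real, Complex.norm_real, Real.norm_eq_abs,
        norm_pow, Real.norm_of_nonneg (show (0 : ℝ) ≤ 1 + |y| by positivity)]
      gcongr
      calc |y| ^ (j : ℕ) ≤ (1 + |y|) ^ (j : ℕ) :=
            pow_le_pow_left₀ (abs_nonneg y) (by linarith) _
        _ ≤ (1 + |y|) ^ (n - 1) :=
            pow_le_pow_right₀ (by linarith [abs_nonneg y]) (by have := j.2; omega)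
  refine (h.re.const_mul Z⁻¹).congr (.of_forall fun x => ?_)
  have h1 : (Matrix.of fun j k : Fin n => ((x k : ℂ)) ^ (j : ℕ)).det = (vandermondeDet x : ℂ) := by
    rw [vandermondeDet, ← Matrix.det_transpose, ← Matrix.of.apply_symm_apply (Matrix.vandermonde x),
      ofReal_det]
    congr 1
    ext j k
    simp [Matrix.vandermonde_apply]
  simp only [h1, ← ofReal_det, ← Complex.ofReal_mul]
  simp [ensembleDensity]

/-- HCIZ replaces `Δ(s) Δ(x) K(s, x)` by `det[exp(i s_j x_k)]`, and Andréief's identity integrates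
the remaining product of two determinants. -/
theorem vandermondeDet_mul_integral_ensembleDensity {n : ℕ} {v : Fin n → ℝ → ℝ}
    (hv : ∀ k, Integrable (v k)) (Z : ℝ) (s : Fin n → ℝ) :
    (vandermondeDet s : ℂ) * ∫ x, sphericalKernel s x * (ensembleDensity v Z x : ℂ) =
      (Z : ℂ)⁻¹ * (hcizConst n * (n ! : ℕ)) *
        (Matrix.of fun j k => fourierTransform (v k) (s j)).det := by
  have h := integral_det_mul_det (f := fun j y => expI (s j * y)) (g := fun k y => (v k y : ℂ))
    fun j k => integrable_expI_mul (hv k) (s j)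
  simp only [fourierTransform]
  rw [mul_assoc _ (hcizConst n * _), mul_assoc (hcizConst n), ← h, ← integral_const_mul,
    ← integral_const_mul, ← integral_const_mul]
  refine integral_congr_ae (.of_forall fun x => ?_)
  simp only
  have h1 := vandermondeDet_mul_sphericalKernel s x
  rw [expDet] at h1
  rw [← ofReal_det, ensembleDensity]
  push_cast
  linear_combination (Z : ℂ)⁻¹ * ((Matrix.of fun j k : Fin n => v k (x j)).det : ℂ) * h1

theorem IsPE.integrable_weight {n : ℕ} {v : Fin n → ℝ → ℝ} {μ : Measure (Herm n)} (h : IsPE v μ)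
    (k : Fin n) : Integrable fun y => (1 + |y|) ^ (n - 1) * v k y := by
  obtain ⟨hμ, hv, Z, hZ, hpos, hlaw⟩ := h
  have hone : ∫⁻ x, ENNReal.ofReal (ensembleDensity v Z x) = 1 := by
    rw [← setLIntegral_univ, ← withDensity_apply _ MeasurableSet.univ, ← hlaw, measure_univ]
  have hm := aemeasurable_ensembleDensity hv Z
  have hint : Integrable (ensembleDensity v Z) := by
    refine (lintegral_ofReal_ne_top_iff_integrable hm.aestronglyMeasurable hpos).1 ?_
    simp [hone]
  refine RandomHermitian.integrable_weight hv ?_ ?_ k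
  · refine (hint.const_mul Z).congr (.of_forall fun x => ?_)
    simp only [ensembleDensity]
    rw [mul_inv_cancel_left₀ hZ]
  · intro hzero
    have : ∫⁻ x, ENNReal.ofReal (ensembleDensity v Z x) = 0 := by
      rw [lintegral_congr_ae (g := fun _ => 0), lintegral_zero]
      filter_upwards [hzero] with x hx
      rw [ensembleDensity, not_not.1 hx]
      simp
    simp [this] at hone

theorem IsPE.integrable {n : ℕ} {v : Fin n → ℝ → ℝ} {μ : Measure (Herm n)} (h : IsPE v μ)
    (k : Fin n) : Integrable (v k) :=
  integrable_of_weight (h.2.1 k) (h.integrable_weight k)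

/-- The spherical transform of a unitarily invariant polynomial ensemble. -/
theorem IsPE.exists_charTransform_eq {n : ℕ} {v : Fin n → ℝ → ℝ} {μ : Measure (Herm n)}
    (h : IsPE v μ) (hμ : UnitarilyInvariant μ) : ∃ Z : ℝ, Z ≠ 0 ∧ ∀ (V : UG n) (s : Fin n → ℝ),
      (vandermondeDet s : ℂ) * charTransform μ (conj V (hdiag s)) =
        (Z : ℂ)⁻¹ * (hcizConst n * (n ! : ℕ)) *
          (Matrix.of fun j k => fourierTransform (v k) (s j)).det := by
  have hi := h.integrable
  obtain ⟨_, hv, Z, hZ, hpos, hlaw⟩ := h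
  refine ⟨Z, hZ, fun V s => ?_⟩
  have hK : Continuous fun x => sphericalKernel s x := by fun_prop
  rw [← vandermondeDet_mul_integral_ensembleDensity hi Z s,
    charTransform_eq_integral_sphericalKernel hμ,
    ← integral_eigenvalueLaw hK (norm_sphericalKernel_le s) fun σ x => sphericalKernel_comp_perm s x σ,
    hlaw, integral_withDensity_eq_integral_toReal_smul₀
      (aemeasurable_ensembleDensity hv Z).ennreal_ofReal (.of_forall fun x => ENNReal.ofReal_lt_top)]
  congr 1
  refine integral_congr_ae ?_
  filter_upwards [hpos] with x hx
  rw [ENNReal.toReal_ofReal hx, Complex.real_smul, mul_comm]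

theorem charTransform_zero {n : ℕ} (μ : Measure (Herm n)) [IsProbabilityMeasure μ] :
    charTransform μ 0 = 1 := by
  simp [charTransform, pairing, expI_zero]

/-- The spherical transform of a polynomial ensemble of derivative type is a product. -/
theorem IsDPE.exists_charTransform_eq {n : ℕ} {w : ℝ → ℝ} {μ : Measure (Herm n)}
    (h : IsDPE w μ) (hμ : UnitarilyInvariant μ) : ∃ a : ℝ, a ≠ 0 ∧ ∀ (V : UG n) (s : Fin n → ℝ),
      charTransform μ (conj V (hdiag s)) = a * ∏ j, fourierTransform w (s j) := by
  obtain ⟨hw, hPE⟩ := h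
  have := hPE.1
  have hi (k : ℕ) (hk : k < n) : Integrable (iteratedDeriv k w) := hPE.integrable ⟨k, hk⟩
  -- For `n = 0` nothing is known about `w`; the index `j` records that `n` is positive.
  have hiw (j : Fin n) : Integrable w := by
    have := hi 0 j.pos
    rwa [iteratedDeriv_zero] at this
  obtain ⟨Z, hZ, hch⟩ := hPE.exists_charTransform_eq hμ
  set b : ℂ := (Z : ℂ)⁻¹ * (hcizConst n * (n ! : ℕ)) * ∏ k : Fin n, (-Complex.I) ^ (k : ℕ) with hb
  have hprod (V : UG n) (s : Fin n → ℝ) :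
      charTransform μ (conj V (hdiag s)) = b * ∏ j, fourierTransform w (s j) := by
    have hc : Continuous fun s : Fin n → ℝ => conj V (hdiag s) := by fun_prop
    refine eq_of_eq_on_injective (f := fun s => charTransform μ (conj V (hdiag s)))
      (g := fun s => b * ∏ j, fourierTransform w (s j)) ((continuous_charTransform _).comp hc)
      (continuous_const.mul (continuous_finsetProd _ fun j _ =>
        (continuous_fourierTransform (hiw j)).comp (continuous_apply j))) (fun s hs => ?_) s
    have hΔ : (vandermondeDet s : ℂ) ≠ 0 := by
      exact_mod_cast Matrix.det_vandermonde_ne_zero_iff.2 hs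
    refine mul_left_cancel₀ hΔ ?_
    have hdet : (Matrix.of fun j k : Fin n => fourierTransform (iteratedDeriv (k : ℕ) w) (s j)).det =
        (∏ j, fourierTransform w (s j)) * ((∏ k : Fin n, (-Complex.I) ^ (k : ℕ)) *
          (vandermondeDet s : ℂ)) := by
      rw [vandermondeDet, ← Matrix.of.apply_symm_apply (Matrix.vandermonde s), ofReal_det,
        ← Matrix.det_mul_row, ← Matrix.det_mul_column]
      congr 1
      ext j k
      rw [Matrix.of_apply, fourierTransform_iteratedDeriv hw hi (s j) k.2]
      simp only [Matrix.of_apply, Matrix.of_symm_apply, Matrix.vandermonde_apply]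
      push_cast
      rw [← mul_neg, mul_pow]
      ring
    rw [hch V s, hdet, hb]
    ring
  -- At `s = 0` the Fourier transform is `1`, which identifies `b` as the inverse of `(∫ w)^n`; in
  -- particular it is real and nonzero, as the normalization of the sum requires.
  have h1 : (1 : ℂ) = b * ((∏ _j : Fin n, ∫ y, w y : ℝ) : ℂ) := by
    have h2 := hprod 1 0
    have h3 : (hdiag 0 : Herm n) = 0 := by
      ext1
      simp [coe_hdiag]
    rw [conj_one, h3, charTransform_zero] at h2
    rw [h2]
    simp [fourierTransform_zero]
  have h4 : (∏ _j : Fin n, ∫ y, w y) ≠ 0 := by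
    intro h0
    rw [h0] at h1
    simp at h1
  refine ⟨(∏ _j : Fin n, ∫ y, w y)⁻¹, inv_ne_zero h4, fun V s => ?_⟩
  rw [hprod V s]
  congr 1
  push_cast at h1 ⊢
  exact eq_inv_of_mul_eq_one_left h1.symm

theorem charTransform_map_add {Ω : Type*} [MeasurableSpace Ω] {P : Measure Ω} {n : ℕ}
    {X Y : Ω → Herm n} (hX : Measurable X) (hY : Measurable Y) (hXY : IndepFun X Y P) (S : Herm n) :
    charTransform (P.map (X + Y)) S = charTransform (P.map X) S * charTransform (P.map Y) S := by
  have hc : Continuous fun A : Herm n => expI (pairing S A) := by fun_prop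
  have hadd : Measurable (X + Y) := hX.add hY
  rw [charTransform, charTransform, charTransform,
    integral_map hX.aemeasurable hc.aestronglyMeasurable,
    integral_map hY.aemeasurable hc.aestronglyMeasurable,
    integral_map hadd.aemeasurable hc.aestronglyMeasurable]
  have h := (hXY.comp hc.measurable hc.measurable).integral_fun_mul_eq_mul_integral
    (hc.measurable.comp hX).aestronglyMeasurable (hc.measurable.comp hY).aestronglyMeasurable
  simp only [Function.comp_def] at h
  rw [← h]
  simp only [Pi.add_apply, pairing_add_right, expI_add]

end

end RandomHermitian

theorem mainTheorem5 {Ω : Type*} [MeasurableSpace Ω] (P : Measure Ω) [IsProbabilityMeasure P]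
    {n : ℕ} (X Y : Ω → RandomHermitian.Herm n) (hX : Measurable X) (hY : Measurable Y)
    (hXY : IndepFun X Y P)
    (hXinv : RandomHermitian.UnitarilyInvariant (P.map X))
    (hYinv : RandomHermitian.UnitarilyInvariant (P.map Y))
    (w : ℝ → ℝ) (v : Fin n → ℝ → ℝ)
    (hXw : RandomHermitian.IsDPE w (P.map X)) (hYv : RandomHermitian.IsPE v (P.map Y)) :
    (∀ k : Fin n, ∀ᵐ x : ℝ,
        ConvolutionExistsAt w (v k) x (ContinuousLinearMap.mul ℝ ℝ) volume) ∧
      RandomHermitian.IsPE (fun k : Fin n => w ⋆[ContinuousLinearMap.mul ℝ ℝ, volume] v k)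
        (P.map (X + Y)) := by
  have hww (k : Fin n) : Integrable fun y => (1 + |y|) ^ (n - 1) * w y := by
    have := hXw.2.integrable_weight ⟨0, k.pos⟩
    simpa only [iteratedDeriv_zero] using this
  have hwm (k : Fin n) : AEMeasurable w := by
    have := hXw.2.2.1 ⟨0, k.pos⟩
    simpa only [iteratedDeriv_zero] using this
  have hwi (k : Fin n) : Integrable w := RandomHermitian.integrable_of_weight (hwm k) (hww k)
  have hconv (k : Fin n) := (hwi k).integrable_convolution (ContinuousLinearMap.mul ℝ ℝ)
    (hYv.integrable k)
  have hconvm (k : Fin n) := (hconv k).aestronglyMeasurable.aemeasurable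
  refine ⟨fun k => (hwi k).ae_convolution_exists _ (hYv.integrable k), ?_⟩
  have hadd : Measurable (X + Y) := hX.add hY
  have hprob : IsProbabilityMeasure (P.map (X + Y)) :=
    Measure.isProbabilityMeasure_map hadd.aemeasurable
  obtain ⟨a, ha, hXch⟩ := hXw.exists_charTransform_eq hXinv
  obtain ⟨Z, hZ, hYch⟩ := hYv.exists_charTransform_eq hYinv
  -- The HCIZ constant and `n!` occur identically in the transforms for `Y` and for the candidate
  -- density, so only `Z` from `Y` and the factor `a` from `X` remain.
  refine ⟨hprob, hconvm, Z / a, div_ne_zero hZ ha, ?_⟩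
  refine RandomHermitian.eigenvalueLaw_eq_withDensity
    (RandomHermitian.integrable_ensembleDensity hconvm (fun k =>
      RandomHermitian.integrable_weight_convolution (hwm k) (hYv.2.1 k) (hww k)
        (hYv.integrable_weight k)) (Z / a))
    (fun σ x => RandomHermitian.ensembleDensity_comp_perm _ _ σ x) fun V s hs => ?_
  have hΔ : (RandomHermitian.vandermondeDet s : ℂ) ≠ 0 := by
    exact_mod_cast Matrix.det_vandermonde_ne_zero_iff.2 hs
  refine mul_left_cancel₀ hΔ ?_
  -- The product form of the transform of `X` matters here: the factor `ŵ(s_j)` multiplies row `j`,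
  -- and entrywise it turns `v̂_k` into the transform of the convolution.
  have hdet : (Matrix.of fun j k => RandomHermitian.fourierTransform
      (w ⋆[ContinuousLinearMap.mul ℝ ℝ, volume] v k) (s j)).det =
        (∏ j, RandomHermitian.fourierTransform w (s j)) *
          (Matrix.of fun j k => RandomHermitian.fourierTransform (v k) (s j)).det := by
    rw [← Matrix.det_mul_column]
    congr 1
    ext j k
    exact RandomHermitian.fourierTransform_convolution (hwi k) (hYv.integrable k) (s j)
  rw [RandomHermitian.charTransform_map_add hX hY hXY,
    RandomHermitian.vandermondeDet_mul_integral_ensembleDensity hconv, hdet, hXch]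
  push_cast
  rw [inv_div]
  linear_combination (a * ∏ j, RandomHermitian.fourierTransform w (s j)) * hYch V s
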